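/- Let $\mathcal X$ be a Polish space whose topology is given by a metric $d$ with $d\le 1$. For finite positive measures $\mu,\pi$ on $\mathcal X$ set $$\|\mu-\pi\|_1=\sup\Bigl\{\int f\,d\mu-\int f\,d\pi \;:\; f\colon\mathcal X\to\mathbb R,\ \mathrm{Lip}\, f\le 1,\ \|f\|_\infty\le 1\Bigr\}.$$ Given a measurable map $\mathcal Q$ from $\mathcal X$ to the finite positive measures on $\mathcal X$ and a point $x\in\mathcal X$, put $\mu^0_x=\delta_x$ and, for $k\ge 0$, let $\mu^{k+1}_x$ be, conditionally on $\mu^0_x,\dots,\mu^k_x$, a realisation of a Poisson point process with intensity measure $\int_{\mathcal X}\mathcal Q(y,\cdot)\,\mu^k_x(dy)$. The random measure $\mu^{[n]}_x=\sum_{k=0}^n\mu^k_x$ is called the recursive Poisson point process of depth $n$ with kernel $\mathcal Q$. **Theorem.** For every $K\ge 1$ and every integer $n>0$ there is a constant $C>0$, depending only on $K$ and $n$, such that the following holds. Let $(\mathcal X,d)$ be as above, let $\mathcal Q,\bar{\mathcal Q}$ be two measurable maps from $\mathcal X$ to the finite positive measures on $\mathcal X$, and let $A\subset\mathcal X$ be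 measurable and $\varepsilon\in(0,1]$ be such that $$\sup_{x\in\mathcal X}\mathcal Q(x,\mathcal X)\le K,\qquad \|\mathcal Q(x)-\mathcal Q(y)\|_1\le K\,d(x,y)\quad\text{for all }x,y\in\mathcal X,$$ $$\sup_{x\in A}\bar{\mathcal Q}(x,\mathcal X\setminus A)\le\varepsilon,\qquad \sup_{x\in A}\|\mathcal Q(x)-\bar{\mathcal Q}(x)\|_1\le\varepsilon .$$ Let $\bar x\in A$ and $x\in\mathcal X$, and let $\mu^{[n]}_x$ and $\bar\mu^{[n]}_{\bar x}$ be the recursive Poisson point processes of depth $n$ with respective kernels $\mathcal Q$ and $\bar{\mathcal Q}$. Then there exists a coupling of $\mu^{[n]}_x$ and $\bar\mu^{[n]}_{\bar x}$ such that $$\mathbf E\bigl(1\wedge\|\mu^{[n]}_x-\bar\mu^{[n]}_{\bar x}\|_1\bigr)\le C\bigl(\sqrt\varepsilon+d(x,\bar x)\bigr).$$ -/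

import Mathlib

open MeasureTheory ProbabilityTheory Set

open scoped ENNReal Nat

universe u

noncomputable section

namespace RecursivePPP

section PointProcess

variable {X : Type u} [MeasurableSpace X]

/-- The (unnormalised) law of the point configuration `δ_{y₁} + ⋯ + δ_{yₖ}`, where
`(y₁, …, yₖ)` is distributed according to the product measure `π^{⊗k}`. -/
def pointSumLaw (k : ℕ) (π : Measure X) : Measure (Measure X) :=
  (Measure.pi fun _ : Fin k => π).map fun y => ∑ i, Measure.dirac (y i)

/-- The law of the Poisson point process with finite intensity measure `π`, a probability measure
on the space of measures on `X`: it has `k` points with probability `e^{-π(X)} π(X)^k / k!` and,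
given that there are `k` points, these are i.i.d. with law `π / π(X)`. Equivalently, it is
`e^{-π(X)} ∑ₖ (1 / k!) · law of (δ_{y₁} + ⋯ + δ_{yₖ}) under π^{⊗k}`.
(Intensities of infinite mass do not occur below; they get the arbitrary value `δ_0`.) -/
def poissonPointProcess (π : Measure X) : Measure (Measure X) :=
  open Classical in
  if IsFiniteMeasure π then
    Measure.sum fun k : ℕ =>
      ENNReal.ofReal (Real.exp (-π.real univ) / (k ! : ℝ)) • pointSumLaw k π
  else Measure.dirac 0

theorem measurable_sum_dirac (k : ℕ) :
    Measurable fun y : Fin k → X => ∑ i, Measure.dirac (y i) := by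
  refine Finset.measurable_fun_sum _ fun i _ => ?_
  exact Measure.measurable_dirac.comp (measurable_pi_apply i)

theorem measurableSet_isFiniteMeasure : MeasurableSet {π : Measure X | IsFiniteMeasure π} := by
  have h : {π : Measure X | IsFiniteMeasure π} = (fun π : Measure X => π univ) ⁻¹' (Iio ∞) := by
    ext π
    exact isFiniteMeasure_iff π
  rw [h]
  exact Measure.measurable_coe MeasurableSet.univ measurableSet_Iio

theorem measurable_pi_const (k : ℕ) :
    Measurable fun π : {π : Measure X // IsFiniteMeasure π} =>
      Measure.pi fun _ : Fin k => (π : Measure X) := by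
  have : ∀ π : {π : Measure X // IsFiniteMeasure π}, IsFiniteMeasure (π : Measure X) :=
    fun π => π.2
  refine Measurable.measure_of_isPiSystem generateFrom_pi.symm isPiSystem_pi ?_ ?_
  · rintro _ ⟨s, hs, rfl⟩
    simp only [Measure.pi_pi]
    refine Finset.measurable_fun_prod _ fun i _ => ?_
    exact (Measure.measurable_coe (hs i (mem_univ i))).comp measurable_subtype_coe
  · simp only [Measure.pi_univ]
    refine Finset.measurable_fun_prod _ fun i _ => ?_
    exact (Measure.measurable_coe MeasurableSet.univ).comp measurable_subtype_coe

theorem measurable_poissonPointProcess :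
    Measurable (poissonPointProcess : Measure X → Measure (Measure X)) := by
  refine measurable_of_restrict_of_restrict_compl measurableSet_isFiniteMeasure ?_ ?_
  · have h : ({π : Measure X | IsFiniteMeasure π}.domRestrict poissonPointProcess) =
        fun π : {π : Measure X // IsFiniteMeasure π} => Measure.sum fun k : ℕ =>
          ENNReal.ofReal (Real.exp (-(π : Measure X).real univ) / (k ! : ℝ)) •
            pointSumLaw k (π : Measure X) := by
      funext π
      have := π.2
      simp only [domRestrict_apply, poissonPointProcess]
      rw [if_pos]
      exact this
    rw [h]
    refine Measure.measurable_of_measurable_coe _ fun s hs => ?_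
    simp only [Measure.sum_apply _ hs, Measure.smul_apply, smul_eq_mul]
    refine Measurable.tsum fun k => Measurable.mul ?_ ?_
    · refine ENNReal.measurable_ofReal.comp (Measurable.div_const (Real.measurable_exp.comp ?_) _)
      refine Measurable.neg (ENNReal.measurable_toReal.comp ?_)
      exact (Measure.measurable_coe MeasurableSet.univ).comp measurable_subtype_coe
    · exact (Measure.measurable_coe hs).comp
        ((Measure.measurable_map _ (measurable_sum_dirac k)).comp (measurable_pi_const k))
  · have h : ({π : Measure X | IsFiniteMeasure π}ᶜ.domRestrict poissonPointProcess) =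
        fun _ => Measure.dirac 0 := by
      funext π
      have := π.2
      simp only [domRestrict_apply, poissonPointProcess]
      rw [if_neg]
      exact this
    rw [h]
    exact measurable_const

theorem isProbabilityMeasure_poissonPointProcess (π : Measure X) :
    IsProbabilityMeasure (poissonPointProcess π) := by
  unfold poissonPointProcess
  split_ifs with h
  · constructor
    rw [Measure.sum_apply _ MeasurableSet.univ]
    have key : ∀ k : ℕ,
        (ENNReal.ofReal (Real.exp (-π.real univ) / (k ! : ℝ)) • pointSumLaw k π) univ =
        ENNReal.ofReal (Real.exp (-π.real univ) * (π.real univ ^ k / (k ! : ℝ))) := by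
      intro k
      have h1 : pointSumLaw k π univ = ENNReal.ofReal (π.real univ ^ k) := by
        rw [pointSumLaw, Measure.map_apply (measurable_sum_dirac k) MeasurableSet.univ,
          preimage_univ, Measure.pi_univ, Finset.prod_const, Finset.card_univ, Fintype.card_fin,
          ENNReal.ofReal_pow measureReal_nonneg, ofReal_measureReal]
      rw [Measure.smul_apply, smul_eq_mul, h1, ← ENNReal.ofReal_mul (by positivity)]
      congr 1
      ring
    simp only [key]
    have hs : HasSum (fun k : ℕ => Real.exp (-π.real univ) * (π.real univ ^ k / (k ! : ℝ))) 1 := by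
      have := (NormedSpace.expSeries_div_hasSum_exp (π.real univ)).mul_left
        (Real.exp (-π.real univ))
      rwa [← Real.exp_eq_exp_ℝ, ← Real.exp_add, neg_add_cancel, Real.exp_zero] at this
    rw [← ENNReal.ofReal_tsum_of_nonneg (fun k => by positivity) hs.summable, hs.tsum_eq,
      ENNReal.ofReal_one]
  · infer_instance

/-- Sampling a Poisson point process, as a Markov kernel in its intensity measure. -/
def poissonKernel : Kernel (Measure X) (Measure X) :=
  ⟨poissonPointProcess, measurable_poissonPointProcess⟩

instance : IsMarkovKernel (poissonKernel (X := X)) :=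
  ⟨fun π => isProbabilityMeasure_poissonPointProcess π⟩

/-- The passage from one generation to the next in a recursive Poisson point process. The first
argument is a pair `(μ^{[n]}, μ^n)`; the next generation `μ^{n+1}` is, conditionally on it, a
Poisson point process with intensity `∫ Q(y) μ^n(dy)`, independent of the earlier generations. -/
def nextGeneration (Q : Kernel X X) : Kernel (Measure X × Measure X) (Measure X) :=
  poissonKernel.comap (fun p : Measure X × Measure X => p.2.bind Q)
    ((Measure.measurable_bind' Q.measurable).comp measurable_snd)

instance (Q : Kernel X X) : IsMarkovKernel (nextGeneration Q) :=
  inferInstanceAs (IsMarkovKernel (poissonKernel.comap _ _))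

/-- The joint law of `(μ_x^{[n]}, μ_x^n)`, where `μ_x^0 = δ_x`, `μ_x^{n+1}` is a Poisson point
process with intensity `∫ Q(y) μ_x^n(dy)` and `μ_x^{[n]} = μ_x^0 + ⋯ + μ_x^n`. -/
def recursivePPPPairLaw (Q : Kernel X X) (x : X) : ℕ → Measure (Measure X × Measure X)
  | 0 => Measure.dirac (Measure.dirac x, Measure.dirac x)
  | n + 1 => (recursivePPPPairLaw Q x n ⊗ₘ nextGeneration Q).map fun q => (q.1.1 + q.2, q.2)

/-- The law of the recursive Poisson point process `μ_x^{[n]}` of depth `n` with kernel `Q`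
and initial condition `x`. -/
def recursivePPP (Q : Kernel X X) (x : X) (n : ℕ) : Measure (Measure X) :=
  (recursivePPPPairLaw Q x n).map Prod.fst

end PointProcess

/-- The distance `‖μ - π‖₁ = sup {∫ f dμ - ∫ f dπ : Lip f ≤ 1, ‖f‖_∞ ≤ 1}` between two finite
measures (not necessarily of the same mass) on a metric space. -/
def wasserstein {X : Type u} [MetricSpace X] [MeasurableSpace X] (μ π : Measure X) : ℝ≥0∞ :=
  ⨆ f : {f : X → ℝ // LipschitzWith 1 f ∧ ∀ x, |f x| ≤ 1},
    ENNReal.ofReal ((∫ x, f.1 x ∂μ) - ∫ x, f.1 x ∂π)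

end RecursivePPP

end

namespace RecursivePPP

section PoissonTheory

variable {X : Type*} [MeasurableSpace X]

/-! ### Poisson point processes -/

/-! The two processes are coupled generation by generation. Conditionally on the past, the next
generations are Poisson with intensities `b.bind Q` and `b'.bind Qbar`, where `b`, `b'` are the
current last generations, so two estimates are needed.

First, Poisson processes with intensities `π`, `π'` can be coupled with expected distance at most
`‖π - π'‖₁` plus any fixed error (`exists_poisson_coupling`). By duality, `‖π - π'‖₁` is, up to that
error, the cost of a partial transport plan `γ` in which unmatched mass costs `1` per unit. A
Poisson process of pairs with intensity `γ` is projected to both sides and independent Poisson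
processes of unmatched points are added. The mapping and superposition theorems give the marginals,
Campbell's formula the expected cost. To be used as a kernel, the plan must depend measurably on the
intensities: plans are discretised to a countable family and a nearly optimal member is selected
(`exists_measurable_plan`). Finite duality (`exists_finite_plan`) comes from Farkas' lemma.

Second, if `b'` is carried by `A`, the intensities differ by at most `K ‖b - b'‖₁ + ε b'(X)`
(`wasserstein_bind_le`).

The second process leaves `A` in one step with probability at most `ε` times the expected mass of
its last generation. `IsCoupledChain.succ` propagates three numbers: the expected distance while the
second process stays in `A`, the probability that it has left, and the expected mass of its last
generation while it stays. After `n` steps the first two add up to a constant times `ε + d(x, x̄)`;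
on the exceptional event the truncated distance is at most `1`. The rate is thus linear in `ε`, and
`ε ≤ √ε` concludes. -/

instance isFiniteMeasure_pointSumLaw (k : ℕ) (π : Measure X) [IsFiniteMeasure π] :
    IsFiniteMeasure (pointSumLaw k π) := by
  unfold pointSumLaw; infer_instance

theorem pointSumLaw_univ (k : ℕ) (π : Measure X) [IsFiniteMeasure π] :
    pointSumLaw k π univ = π univ ^ k := by
  rw [pointSumLaw, Measure.map_apply (measurable_sum_dirac k) MeasurableSet.univ]
  simp [Measure.pi_univ]

theorem pointSumLaw_zero (π : Measure X) [IsFiniteMeasure π] :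
    pointSumLaw 0 π = Measure.dirac 0 := by
  rw [pointSumLaw, Measure.pi_of_empty _ Fin.elim0, Measure.map_dirac' (measurable_sum_dirac 0)]
  simp

/-- One factor splits off the product measure, and adding its point is a convolution. This makes
induction on the number of points possible. -/
theorem pointSumLaw_succ (k : ℕ) (π : Measure X) [IsFiniteMeasure π] :
    pointSumLaw (k + 1) π = (π.map Measure.dirac).conv (pointSumLaw k π) := by
  have e := measurePreserving_piFinSuccAbove (fun _ : Fin (k + 1) => π) 0
  have h : Measurable fun p : Measure X × Measure X => p.1 + p.2 := by fun_prop
  rw [Measure.conv, pointSumLaw, pointSumLaw,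
    Measure.map_prod_map _ _ Measure.measurable_dirac (measurable_sum_dirac k), ← e.map_eq,
    Measure.map_map (by fun_prop)
      (Measure.measurable_dirac.prodMap (measurable_sum_dirac k)),
    Measure.map_map (h.comp (Measure.measurable_dirac.prodMap (measurable_sum_dirac k)))
      e.measurable]
  congr 1
  funext y
  simp [Fin.sum_univ_succ, MeasurableEquiv.piFinSuccAbove, Fin.tail]

theorem conv_sum_right {M : Type*} [AddMonoid M] [MeasurableSpace M] [MeasurableAdd₂ M] {ι : Type*}
    (s : Finset ι) (μ : Measure M) [IsFiniteMeasure μ] (ν : ι → Measure M)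
    [∀ i, IsFiniteMeasure (ν i)] :
    μ.conv (∑ i ∈ s, ν i) = ∑ i ∈ s, μ.conv (ν i) := by
  classical
  induction s using Finset.induction_on with
  | empty => simp
  | insert a s ha ih =>
    rw [Finset.sum_insert ha, Finset.sum_insert ha, Measure.conv_add, ih]

/-- The binomial theorem in the commutative convolution algebra, since `pointSumLaw k π` is a `k`-th
convolution power. -/
theorem pointSumLaw_add (k : ℕ) (π₁ π₂ : Measure X) [IsFiniteMeasure π₁] [IsFiniteMeasure π₂] :
    pointSumLaw k (π₁ + π₂) = ∑ ij ∈ Finset.HasAntidiagonal.antidiagonal k,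
      k.choose ij.1 • (pointSumLaw ij.1 π₁).conv (pointSumLaw ij.2 π₂) := by
  induction k with
  | zero => simp [pointSumLaw_zero]
  | succ k ih =>
    have hsm : ∀ (c : ℕ) (μ ν : Measure (Measure X)) [IsFiniteMeasure μ] [IsFiniteMeasure ν],
        μ.conv (c • ν) = c • μ.conv ν := by
      intro c μ ν _ _
      rw [← Nat.cast_smul_eq_nsmul ℝ≥0∞ c ν, Measure.conv_smul_right, Nat.cast_smul_eq_nsmul]
    rw [pointSumLaw_succ, Measure.map_add _ _ Measure.measurable_dirac, Measure.add_conv, ih,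
      Finset.sum_antidiagonal_choose_succ_nsmul
        (fun i j => (pointSumLaw i π₁).conv (pointSumLaw j π₂)), add_comm,
      conv_sum_right, conv_sum_right]
    congr 1
    · refine Finset.sum_congr rfl fun ij _ => ?_
      rw [hsm, pointSumLaw_succ, ← Measure.conv_assoc, ← Measure.conv_assoc,
        Measure.conv_comm (π₂.map _)]
    · refine Finset.sum_congr rfl fun ij hij => ?_
      rw [hsm, pointSumLaw_succ, ← Measure.conv_assoc,
        Nat.choose_symm_of_eq_add (Finset.HasAntidiagonal.mem_antidiagonal.1 hij).symm]

theorem poissonPointProcess_eq (π : Measure X) [h : IsFiniteMeasure π] :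
    poissonPointProcess π = Measure.sum fun k : ℕ =>
      ENNReal.ofReal (Real.exp (-π.real univ) / (k ! : ℝ)) • pointSumLaw k π := by
  rw [poissonPointProcess, if_pos h]

instance (π : Measure X) : IsProbabilityMeasure (poissonPointProcess π) :=
  isProbabilityMeasure_poissonPointProcess π

theorem poissonPointProcess_of_not_isFiniteMeasure {π : Measure X} (h : ¬ IsFiniteMeasure π) :
    poissonPointProcess π = Measure.dirac 0 := by
  rw [poissonPointProcess, if_neg h]

theorem poissonPointProcess_zero : poissonPointProcess (0 : Measure X) = Measure.dirac 0 := by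
  rw [poissonPointProcess_eq]
  ext s hs
  rw [Measure.sum_apply _ hs, tsum_eq_single 0]
  · simp [pointSumLaw_zero]
  · intro k hk
    have : pointSumLaw k (0 : Measure X) = 0 := by
      rw [← Measure.measure_univ_eq_zero, pointSumLaw_univ]
      simp [hk]
    simp [this]

/-- Total mass one of the Poisson law, read off its defining series; it sums the series in
Campbell's formula. -/
theorem poisson_weights (π : Measure X) [IsFiniteMeasure π] :
    ∑' k : ℕ, ENNReal.ofReal (Real.exp (-π.real univ) / (k ! : ℝ)) * π univ ^ k = 1 := by
  have := measure_univ (μ := poissonPointProcess π)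
  rw [poissonPointProcess_eq, Measure.sum_apply _ MeasurableSet.univ] at this
  simpa [pointSumLaw_univ] using this

/-- Superposition of independent Poisson point processes. -/
theorem poissonPointProcess_add (π₁ π₂ : Measure X) [IsFiniteMeasure π₁] [IsFiniteMeasure π₂] :
    poissonPointProcess (π₁ + π₂) = (poissonPointProcess π₁).conv (poissonPointProcess π₂) := by
  rw [poissonPointProcess_eq, poissonPointProcess_eq, poissonPointProcess_eq, Measure.conv,
    Measure.prod_sum, Measure.map_sum (by fun_prop)]
  ext s hs
  rw [Measure.sum_apply _ hs, Measure.sum_apply _ hs,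
    -- Regroup the double series by the total number `k = i + j` of points; the binomial coefficient
    -- then turns `1 / k!` into `1 / (i! j!)`.
    ← Finset.HasAntidiagonal.sigmaAntidiagonalEquivProd.tsum_eq, ENNReal.tsum_sigma']
  refine tsum_congr fun k => ?_
  rw [tsum_fintype, Finset.univ_eq_attach, pointSumLaw_add, Finset.smul_sum,
    ← Finset.sum_attach, Measure.finsetSum_apply]
  refine Finset.sum_congr rfl fun ij _ => ?_
  obtain ⟨⟨i, j⟩, hij⟩ := ij
  have hk : i + j = k := Finset.HasAntidiagonal.mem_antidiagonal.1 hij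
  subst hk
  change _ = Measure.conv (ENNReal.ofReal (Real.exp (-π₁.real univ) / (i ! : ℝ)) • pointSumLaw i π₁)
    (ENNReal.ofReal (Real.exp (-π₂.real univ) / (j ! : ℝ)) • pointSumLaw j π₂) s
  rw [Measure.conv_smul_left, Measure.conv_smul_right, smul_smul,
    ← Nat.cast_smul_eq_nsmul ℝ≥0∞, smul_smul, ← ENNReal.ofReal_mul (by positivity),
    ← ENNReal.ofReal_natCast, ← ENNReal.ofReal_mul (by positivity)]
  congr 3
  rw [measureReal_add_apply, neg_add, Real.exp_add]
  have h := Nat.choose_symm_add ▸ Nat.add_choose_mul_factorial_mul_factorial i j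
  have h' : ((i + j).choose i : ℝ) * i ! * j ! = (i + j)! := by exact_mod_cast h
  rw [← h']
  have : ((i + j).choose i : ℝ) ≠ 0 := by
    exact_mod_cast (Nat.choose_pos (Nat.le_add_right i j)).ne'
  field_simp

theorem pointSumLaw_map {Y : Type*} [MeasurableSpace Y] (k : ℕ) (π : Measure X)
    [IsFiniteMeasure π] {f : X → Y} (hf : Measurable f) :
    pointSumLaw k (π.map f) = (pointSumLaw k π).map (Measure.map f) := by
  rw [pointSumLaw, pointSumLaw, Measure.map_map (Measure.measurable_map f hf)
    (measurable_sum_dirac k), ← Measure.pi_map_pi (fun _ => hf.aemeasurable),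
    Measure.map_map (measurable_sum_dirac k) (by fun_prop)]
  congr 1
  funext y
  simp [← Measure.mapₗ_apply_of_measurable hf, map_sum]
  simp [Measure.mapₗ_apply_of_measurable hf, Measure.map_dirac' hf]

/-- The image of a Poisson point process under a measurable map. -/
theorem poissonPointProcess_map {Y : Type*} [MeasurableSpace Y] (π : Measure X)
    [IsFiniteMeasure π] {f : X → Y} (hf : Measurable f) :
    poissonPointProcess (π.map f) = (poissonPointProcess π).map (Measure.map f) := by
  rw [poissonPointProcess_eq, poissonPointProcess_eq,
    Measure.map_sum (Measure.measurable_map f hf).aemeasurable]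
  congr 1
  funext k
  rw [Measure.map_smul, pointSumLaw_map k π hf, map_measureReal_apply hf MeasurableSet.univ,
    preimage_univ]

theorem lintegral_pointSumLaw (k : ℕ) (π : Measure X) [IsFiniteMeasure π] {g : X → ℝ≥0∞}
    (hg : Measurable g) :
    ∫⁻ η, ∫⁻ x, g x ∂η ∂(pointSumLaw (k + 1) π) = (k + 1) * π univ ^ k * ∫⁻ x, g x ∂π := by
  rw [pointSumLaw, lintegral_map (Measure.measurable_lintegral hg) (measurable_sum_dirac _)]
  have h1 : ∀ i : Fin (k + 1), ∫⁻ y, g (y i) ∂(Measure.pi fun _ : Fin (k + 1) => π) =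
      π univ ^ k * ∫⁻ x, g x ∂π := by
    intro i
    have := Measure.pi_map_eval (fun _ : Fin (k + 1) => π) i
    rw [← lintegral_map hg (measurable_pi_apply i)]
    exact (congrArg (fun μ => ∫⁻ a, g a ∂μ) this).trans (by simp [lintegral_smul_measure])
  simp only [lintegral_finsetSum_measure]
  rw [lintegral_finsetSum _ (fun i _ => by
    simp_rw [lintegral_dirac' _ hg]; exact hg.comp (measurable_pi_apply i))]
  simp_rw [lintegral_dirac' _ hg, h1]
  simp [mul_assoc]

/-- Campbell's formula for the mean measure of a Poisson point process. -/
theorem lintegral_poissonPointProcess (π : Measure X) [IsFiniteMeasure π] {g : X → ℝ≥0∞}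
    (hg : Measurable g) :
    ∫⁻ η, ∫⁻ x, g x ∂η ∂(poissonPointProcess π) = ∫⁻ x, g x ∂π := by
  rw [poissonPointProcess_eq, lintegral_sum_measure, tsum_eq_zero_add' ENNReal.summable]
  have h0 : ∫⁻ η, ∫⁻ x, g x ∂η ∂(pointSumLaw 0 π) = 0 := by
    rw [pointSumLaw_zero, lintegral_dirac' _ (Measure.measurable_lintegral hg)]
    simp
  rw [lintegral_smul_measure, h0, smul_zero, zero_add]
  simp_rw [lintegral_smul_measure, lintegral_pointSumLaw _ π hg, smul_eq_mul]
  -- The factor `k + 1` counting the points cancels against `(k + 1)!`, so the shifted series has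
  -- the Poisson weights again.
  have h1 : ∀ k : ℕ, ENNReal.ofReal (Real.exp (-π.real univ) / ((k + 1)! : ℝ)) *
      ((k + 1) * π univ ^ k * ∫⁻ x, g x ∂π) =
      (ENNReal.ofReal (Real.exp (-π.real univ) / (k ! : ℝ)) * π univ ^ k) * ∫⁻ x, g x ∂π := by
    intro k
    rw [← mul_assoc, ← mul_assoc]
    congr 2
    have : (k + 1 : ℝ≥0∞) = ENNReal.ofReal (k + 1 : ℝ) := by
      rw [ENNReal.ofReal_add (by positivity) (by positivity)]; simp
    rw [this, ← ENNReal.ofReal_mul (by positivity)]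
    congr 1
    rw [Nat.factorial_succ]
    push_cast
    field_simp
  simp_rw [h1]
  rw [ENNReal.tsum_mul_right, poisson_weights, one_mul]

theorem lintegral_poissonPointProcess_apply (π : Measure X) [IsFiniteMeasure π] {s : Set X}
    (hs : MeasurableSet s) : ∫⁻ η, η s ∂(poissonPointProcess π) = π s := by
  have := lintegral_poissonPointProcess π (measurable_one.indicator hs : Measurable (s.indicator 1))
  simpa [lintegral_indicator hs] using this

theorem ae_isFiniteMeasure_poissonPointProcess (π : Measure X) :
    ∀ᵐ η ∂(poissonPointProcess π), IsFiniteMeasure η := by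
  by_cases h : IsFiniteMeasure π
  · have h1 : ∫⁻ η, η univ ∂(poissonPointProcess π) ≠ ∞ := by
      rw [lintegral_poissonPointProcess_apply π MeasurableSet.univ]
      exact measure_ne_top π univ
    filter_upwards [ae_lt_top (Measure.measurable_coe MeasurableSet.univ) h1] with η hη
    exact ⟨hη⟩
  · rw [poissonPointProcess_of_not_isFiniteMeasure h, ae_dirac_iff measurableSet_isFiniteMeasure]
    infer_instance

end PoissonTheory

section FiniteDuality

/-! ### Duality for finite optimal transport -/

/-- Farkas' lemma for a subspace of `ℝ^T` that contains a strictly positive vector. -/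
theorem exists_nonneg_of_forall_nonneg {P T : Type*} [AddCommGroup P] [Module ℝ P] [Fintype T]
    (Φ : P →ₗ[ℝ] (T → ℝ)) (L : P →ₗ[ℝ] ℝ) (hpos : ∀ x, 0 ≤ Φ x → 0 ≤ L x)
    (hone : ∃ x, ∀ t, 1 ≤ Φ x t) :
    ∃ g : T → ℝ, 0 ≤ g ∧ ∀ x, L x = ∑ t, g t * Φ x t := by
  classical
  -- On the kernel, positivity applies to both `x` and `-x`, so `L` vanishes there and factors
  -- through `Φ`.
  have hker : L ∈ (LinearMap.ker Φ).dualAnnihilator := by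
    rw [Submodule.mem_dualAnnihilator]
    intro x hx
    have hx0 : Φ x = 0 := hx
    have h1 := hpos x hx0.ge
    have h2 := hpos (-x) (by simp [hx0])
    rw [map_neg] at h2
    linarith
  rw [← LinearMap.range_dualMap_eq_dualAnnihilator_ker] at hker
  obtain ⟨L', hL'⟩ := hker
  have hL : ∀ x, L x = L' (Φ x) := fun x => by rw [← hL']; rfl
  obtain ⟨x₀, hx₀⟩ := hone
  -- Extend the factored functional from the range of `Φ` to a positive functional on `ℝ^T`; its
  -- values on the unit vectors are the multipliers. The strictly positive vector in the range,
  -- scaled by `∑ |y t|`, dominates `-y` and so supplies the cofinality hypothesis.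
  obtain ⟨G, hG1, hG2⟩ := riesz_extension (PointedCone.positive ℝ (T → ℝ))
    ⟨LinearMap.range Φ, L'.comp (LinearMap.range Φ).subtype⟩
    (by
      rintro ⟨_, x, rfl⟩ hx
      change 0 ≤ L' (Φ x)
      rw [← hL]
      exact hpos x hx)
    (by
      intro y
      refine ⟨⟨Φ ((∑ t, |y t|) • x₀), LinearMap.mem_range_self _ _⟩, fun t => ?_⟩
      have h1 : |y t| ≤ ∑ t, |y t| :=
        Finset.single_le_sum (f := fun t => |y t|) (fun t _ => abs_nonneg _) (Finset.mem_univ t)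
      have h2 := neg_abs_le (y t)
      have h3 := mul_le_mul_of_nonneg_left (hx₀ t) ((abs_nonneg _).trans h1)
      simp only [map_smul, Pi.add_apply, Pi.smul_apply, smul_eq_mul, Pi.zero_apply]
      linarith)
  refine ⟨fun t => G (Pi.single t 1), fun t => hG2 _ ?_, fun x => ?_⟩
  · rw [PointedCone.mem_positive]
    exact Pi.single_nonneg.2 zero_le_one
  · have h1 : G (Φ x) = L' (Φ x) := hG1 ⟨Φ x, LinearMap.mem_range_self _ _⟩
    rw [hL, ← h1]
    conv_lhs => rw [← Finset.univ_sum_single (Φ x), map_sum]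
    refine Finset.sum_congr rfl fun t _ => ?_
    have : Pi.single t (Φ x t) = Φ x t • (Pi.single t 1 : T → ℝ) := by
      rw [← Pi.single_smul]; simp
    rw [this, map_smul, smul_eq_mul, mul_comm]

variable {X : Type*} [MetricSpace X]

/-- The `c`-transform of the function `a j ↦ β j`, truncated at `1`. -/
theorem exists_lipschitz_transform {I : Type*} (a : I → X) (β : I → ℝ) (hβ : ∀ i, β i ≤ 1)
    (s : Finset I) :
    ∃ F : X → ℝ, LipschitzWith 1 F ∧ (∀ x, |F x| ≤ 1) ∧ (∀ j ∈ s, F (a j) ≤ -β j) ∧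
      ∀ x c, c ≤ 1 → (∀ j ∈ s, c ≤ dist x (a j) - β j) → c ≤ F x := by
  classical
  induction s using Finset.induction_on with
  | empty => exact ⟨fun _ => 1, LipschitzWith.const' 1, by simp, by simp, by simp⟩
  | insert j s hj ih =>
    obtain ⟨F, hF1, hF2, hF3, hF4⟩ := ih
    refine ⟨fun x => min (F x) (dist x (a j) - β j), ?_, ?_, ?_, ?_⟩
    · have h : LipschitzWith 1 fun x => dist x (a j) - β j := by
        refine LipschitzWith.of_le_add fun x y => ?_
        have := dist_triangle x y (a j)
        linarith
      simpa using hF1.min h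
    · intro x
      have h1 := abs_le.1 (hF2 x)
      have h2 := hβ j
      have h3 := dist_nonneg (x := x) (y := a j)
      rw [abs_le]
      exact ⟨le_min h1.1 (by linarith), (min_le_left _ _).trans h1.2⟩
    · intro i hi
      rcases Finset.mem_insert.1 hi with rfl | hi
      · exact (min_le_right _ _).trans (by simp)
      · exact (min_le_left _ _).trans (hF3 i hi)
    · intro x c hc h
      exact le_min (hF4 x c hc fun i hi => h i (Finset.mem_insert_of_mem hi))
        (h j (Finset.mem_insert_self _ _))

/-- Kantorovich duality for partial transport between two finitely supported measures, where
unmatched mass costs `1` per unit. -/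
theorem exists_finite_plan {I : Type*} [Fintype I] (a : I → X) (p q : I → ℝ)
    (hp : ∀ i, 0 ≤ p i) (hq : ∀ i, 0 ≤ q i) (W : ℝ)
    (hW : ∀ F : X → ℝ, LipschitzWith 1 F → (∀ x, |F x| ≤ 1) → ∑ i, F (a i) * (p i - q i) ≤ W) :
    ∃ g : I → I → ℝ, (∀ i j, 0 ≤ g i j) ∧ (∀ i, ∑ j, g i j ≤ p i) ∧ (∀ j, ∑ i, g i j ≤ q j) ∧
      ∑ i, ∑ j, g i j * dist (a i) (a j) + ∑ i, (p i - ∑ j, g i j) + ∑ j, (q j - ∑ i, g i j)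
        ≤ W := by
  classical
  -- If leaving everything unmatched is cheap enough, take the zero plan. Otherwise `W` is at most
  -- the total mass, which is needed below when `t ≤ 0`.
  rcases le_total (∑ i, p i + ∑ i, q i) W with hle | hle
  · exact ⟨0, by simp, by simpa using hp, by simpa using hq, by simpa using hle⟩
  -- The homogenised dual problem: `u`, `v` are potentials and `t` multiplies the cost. The Farkas
  -- multipliers will be the transported masses on `I × I` and the unmatched masses on the two
  -- copies of `I`.
  let Φ : ((I → ℝ) × (I → ℝ) × ℝ) →ₗ[ℝ] ((I × I) ⊕ I ⊕ I → ℝ) :=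
    { toFun := fun w => Sum.elim (fun ij => w.1 ij.1 + w.2.1 ij.2 + w.2.2 * dist (a ij.1) (a ij.2))
        (Sum.elim (fun i => w.1 i + w.2.2) (fun j => w.2.1 j + w.2.2))
      map_add' := by
        intro w w'
        funext t
        rcases t with t | t | t <;> simp <;> ring
      map_smul' := by
        intro c w
        funext t
        rcases t with t | t | t <;> simp <;> ring }
  let L : ((I → ℝ) × (I → ℝ) × ℝ) →ₗ[ℝ] ℝ :=
    { toFun := fun w => ∑ i, w.1 i * p i + ∑ i, w.2.1 i * q i + w.2.2 * W
      map_add' := by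
        intro w w'
        simp only [Prod.fst_add, Prod.snd_add, Pi.add_apply, add_mul, Finset.sum_add_distrib]
        ring
      map_smul' := by
        intro c w
        simp only [Prod.smul_fst, Prod.smul_snd, Pi.smul_apply, smul_eq_mul, mul_assoc,
          RingHom.id_apply, mul_add, Finset.mul_sum] }
  obtain ⟨g, hg0, hg⟩ := exists_nonneg_of_forall_nonneg Φ L (by
    rintro ⟨u, v, t⟩ h
    have h1 : ∀ i j, 0 ≤ u i + v j + t * dist (a i) (a j) := fun i j => h (Sum.inl (i, j))
    have h2 : ∀ i, 0 ≤ u i + t := fun i => h (Sum.inr (Sum.inl i))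
    have h3 : ∀ i, 0 ≤ v i + t := fun i => h (Sum.inr (Sum.inr i))
    change 0 ≤ ∑ i, u i * p i + ∑ i, v i * q i + t * W
    -- For `t ≤ 0`, the bounds `u i, v i ≥ -t` suffice. For `t > 0`, the truncated transform of `-v
    -- / t` is an admissible test function lying above `-u / t` and below `v / t` at the points `a
    -- i`, and `hW` applies to it.
    rcases le_or_gt t 0 with ht | ht
    · have h4 : ∑ i, (-t) * p i ≤ ∑ i, u i * p i := Finset.sum_le_sum fun i _ =>
        mul_le_mul_of_nonneg_right (by linarith [h2 i]) (hp i)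
      have h5 : ∑ i, (-t) * q i ≤ ∑ i, v i * q i := Finset.sum_le_sum fun i _ =>
        mul_le_mul_of_nonneg_right (by linarith [h3 i]) (hq i)
      rw [← Finset.mul_sum] at h4 h5
      have h6 := mul_le_mul_of_nonneg_left hle (neg_nonneg.2 ht)
      linarith
    · obtain ⟨F, hF1, hF2, hF3, hF4⟩ := exists_lipschitz_transform a (fun j => -v j / t)
        (fun j => by rw [div_le_one ht]; linarith [h3 j]) Finset.univ
      have h4 : ∀ i, -u i ≤ t * F (a i) := by
        intro i
        have := hF4 (a i) (-u i / t) (by rw [div_le_one ht]; linarith [h2 i]) (fun j _ => by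
          rw [div_le_iff₀ ht, sub_mul, div_mul_cancel₀ _ ht.ne']
          linarith [h1 i j])
        rwa [div_le_iff₀' ht] at this
      have h5 : ∀ j, t * F (a j) ≤ v j := by
        intro j
        have := hF3 j (Finset.mem_univ j)
        rwa [neg_div, neg_neg, le_div_iff₀' ht] at this
      have h6 := mul_le_mul_of_nonneg_left (hW F hF1 hF2) ht.le
      have h7 : t * ∑ i, F (a i) * (p i - q i) =
          ∑ i, (t * F (a i)) * p i - ∑ i, (t * F (a i)) * q i := by
        rw [Finset.mul_sum, ← Finset.sum_sub_distrib]
        exact Finset.sum_congr rfl fun i _ => by ring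
      have h8 : ∑ i, -u i * p i ≤ ∑ i, (t * F (a i)) * p i := Finset.sum_le_sum fun i _ =>
        mul_le_mul_of_nonneg_right (h4 i) (hp i)
      have h9 : ∑ i, (t * F (a i)) * q i ≤ ∑ i, v i * q i := Finset.sum_le_sum fun i _ =>
        mul_le_mul_of_nonneg_right (h5 i) (hq i)
      simp only [neg_mul, Finset.sum_neg_distrib] at h8
      linarith) (by
    refine ⟨(fun _ => 1, fun _ => 1, 0), ?_⟩
    rintro (t | t | t) <;> simp [Φ])
  -- Testing the Farkas identity on the coordinate vectors gives the two marginal equations and, in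
  -- direction `t`, that the cost is exactly `W`.
  have hr : ∀ i, ∑ j, g (Sum.inl (i, j)) + g (Sum.inr (Sum.inl i)) = p i := by
    intro i
    have := hg (Pi.single i 1, 0, 0)
    simp [L, Φ, Pi.single_apply, Fintype.sum_prod_type] at this
    rw [this, Finset.sum_comm]
    simp
  have hc : ∀ j, ∑ i, g (Sum.inl (i, j)) + g (Sum.inr (Sum.inr j)) = q j := by
    intro j
    have := hg (0, Pi.single j 1, 0)
    simp [L, Φ, Pi.single_apply, Fintype.sum_prod_type] at this
    rw [this]
  have hw := hg (0, 0, 1)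
  simp [L, Φ, Fintype.sum_prod_type] at hw
  refine ⟨fun i j => g (Sum.inl (i, j)), fun i j => hg0 _, fun i => ?_, fun j => ?_, ?_⟩
  · have := hg0 (Sum.inr (Sum.inl i))
    simp only [Pi.zero_apply] at this
    linarith [hr i]
  · have := hg0 (Sum.inr (Sum.inr j))
    simp only [Pi.zero_apply] at this
    linarith [hc j]
  · have h1 : ∀ i, p i - ∑ j, g (Sum.inl (i, j)) = g (Sum.inr (Sum.inl i)) := fun i => by
      linarith [hr i]
    have h2 : ∀ j, q j - ∑ i, g (Sum.inl (i, j)) = g (Sum.inr (Sum.inr j)) := fun i => by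
      linarith [hc i]
    simp only [h1, h2]
    linarith

end FiniteDuality

theorem abs_integral_le {X : Type*} [MeasurableSpace X] {F : X → ℝ} {b : ℝ} (hb : ∀ x, |F x| ≤ b)
    (μ : Measure X) [IsFiniteMeasure μ] : |∫ x, F x ∂μ| ≤ b * μ.real univ :=
  norm_integral_le_of_norm_le_const (f := F) (ae_of_all _ hb)

section Wasserstein

/-! ### The distance `‖μ - π‖₁` -/

variable {X : Type u} [MetricSpace X] [MeasurableSpace X]

theorem wasserstein_le_ofReal {μ ν : Measure X} {c : ℝ}
    (h : ∀ F : X → ℝ, LipschitzWith 1 F → (∀ x, |F x| ≤ 1) → ∫ x, F x ∂μ - ∫ x, F x ∂ν ≤ c) :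
    wasserstein μ ν ≤ ENNReal.ofReal c :=
  iSup_le fun F => ENNReal.ofReal_le_ofReal (h F.1 F.2.1 F.2.2)

theorem integral_sub_integral_le_of_wasserstein_le {μ ν : Measure X} {c : ℝ} (hc : 0 ≤ c)
    (h : wasserstein μ ν ≤ ENNReal.ofReal c) {F : X → ℝ} (hF : LipschitzWith 1 F)
    (hb : ∀ x, |F x| ≤ 1) : ∫ x, F x ∂μ - ∫ x, F x ∂ν ≤ c :=
  (ENNReal.ofReal_le_ofReal_iff hc).1
    ((le_iSup (fun f : {f : X → ℝ // LipschitzWith 1 f ∧ ∀ x, |f x| ≤ 1} =>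
      ENNReal.ofReal ((∫ x, f.1 x ∂μ) - ∫ x, f.1 x ∂ν)) ⟨F, hF, hb⟩).trans h)

theorem wasserstein_ne_top (μ ν : Measure X) [IsFiniteMeasure μ] [IsFiniteMeasure ν] :
    wasserstein μ ν ≠ ∞ := by
  refine ne_top_of_le_ne_top (ENNReal.ofReal_ne_top (r := μ.real univ + ν.real univ))
    (iSup_le fun F => ENNReal.ofReal_le_ofReal ?_)
  have h1 := abs_le.1 (abs_integral_le F.2.2 μ)
  have h2 := abs_le.1 (abs_integral_le F.2.2 ν)
  linarith

theorem integral_sub_integral_le_toReal_wasserstein {μ ν : Measure X} [IsFiniteMeasure μ]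
    [IsFiniteMeasure ν] {F : X → ℝ} (hF : LipschitzWith 1 F) (hb : ∀ x, |F x| ≤ 1) :
    ∫ x, F x ∂μ - ∫ x, F x ∂ν ≤ (wasserstein μ ν).toReal :=
  integral_sub_integral_le_of_wasserstein_le ENNReal.toReal_nonneg
    (ENNReal.ofReal_toReal (wasserstein_ne_top μ ν)).ge hF hb

variable [BorelSpace X]

theorem integrable_of_lipschitzWith_of_abs_le {F : X → ℝ} {c : NNReal} {b : ℝ}
    (hF : LipschitzWith c F) (hb : ∀ x, |F x| ≤ b) (μ : Measure X) [IsFiniteMeasure μ] :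
    Integrable F μ :=
  Integrable.of_bound hF.continuous.aestronglyMeasurable b (ae_of_all _ hb)

theorem wasserstein_add_le (a b a' b' : Measure X) [IsFiniteMeasure a] [IsFiniteMeasure b]
    [IsFiniteMeasure a'] [IsFiniteMeasure b'] :
    wasserstein (a + b) (a' + b') ≤ wasserstein a a' + wasserstein b b' := by
  rw [← ENNReal.ofReal_toReal (wasserstein_ne_top a a'),
    ← ENNReal.ofReal_toReal (wasserstein_ne_top b b'),
    ← ENNReal.ofReal_add ENNReal.toReal_nonneg ENNReal.toReal_nonneg]
  refine wasserstein_le_ofReal fun F hF hb => ?_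
  have hi : ∀ (μ : Measure X) [IsFiniteMeasure μ], Integrable F μ := fun μ _ =>
    integrable_of_lipschitzWith_of_abs_le hF hb μ
  rw [integral_add_measure (hi _) (hi _), integral_add_measure (hi _) (hi _)]
  have h1 := integral_sub_integral_le_toReal_wasserstein (μ := a) (ν := a') hF hb
  have h2 := integral_sub_integral_le_toReal_wasserstein (μ := b) (ν := b') hF hb
  linarith

end Wasserstein

section Cells

/-! ### Discretisation of a separable metric space -/

variable {X : Type u} [MetricSpace X] [SecondCountableTopology X] [Nonempty X]

theorem exists_dist_denseSeq_lt (L : ℕ) (x : X) :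
    ∃ i, dist x (TopologicalSpace.denseSeq X i) < 1 / ((L : ℝ) + 1) := by
  obtain ⟨y, hy, i, rfl⟩ := Metric.dense_iff.1 (TopologicalSpace.denseRange_denseSeq X) x
    (1 / ((L : ℝ) + 1)) (by positivity)
  exact ⟨i, by rwa [dist_comm]⟩

open Classical in
/-- The index of the first point of the dense sequence at distance less than `1 / (L + 1)`. -/
noncomputable def cell (L : ℕ) (x : X) : ℕ := Nat.find (exists_dist_denseSeq_lt L x)

theorem dist_cell_lt (L : ℕ) (x : X) :
    dist x (TopologicalSpace.denseSeq X (cell L x)) < 1 / ((L : ℝ) + 1) := by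
  classical
  exact Nat.find_spec (exists_dist_denseSeq_lt L x)

variable [MeasurableSpace X] [BorelSpace X]

theorem measurable_cell (L : ℕ) : Measurable (cell L : X → ℕ) := by
  classical
  exact measurable_find _ fun k =>
    measurableSet_lt (by fun_prop) measurable_const

theorem integral_comp_cell (L N : ℕ) (μ : Measure X) [IsFiniteMeasure μ] {ψ : ℕ → ℝ}
    (hψ : ∀ i, N ≤ i → ψ i = 0) :
    Integrable (fun x => ψ (cell L x)) μ ∧
      ∫ x, ψ (cell L x) ∂μ = ∑ i ∈ Finset.range N, ψ i * μ.real (cell L ⁻¹' {i}) := by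
  have hm : ∀ i, MeasurableSet (cell L ⁻¹' {i} : Set X) := fun i =>
    measurable_cell L (measurableSet_singleton i)
  have h : (fun x : X => ψ (cell L x)) = fun x => ∑ i ∈ Finset.range N,
      (cell L ⁻¹' {i}).indicator (fun _ => ψ i) x := by
    funext x
    rcases lt_or_ge (cell L x) N with hx | hx
    · rw [Finset.sum_eq_single (cell L x)]
      · rw [indicator_of_mem (by rfl)]
      · intro i _ hi
        exact indicator_of_notMem (fun h : cell L x = i => hi h.symm) _
      · intro h
        exact absurd (Finset.mem_range.2 hx) h
    · rw [hψ _ hx, Finset.sum_eq_zero]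
      intro i hi
      refine indicator_of_notMem (fun h => ?_) _
      have := Finset.mem_range.1 hi
      have h' : cell L x = i := h
      omega
  have hi : ∀ i, Integrable ((cell L ⁻¹' {i}).indicator (fun _ => ψ i)) μ := fun i =>
    (integrable_const _).indicator (hm i)
  rw [h]
  refine ⟨integrable_finsetSum _ fun i _ => hi i, ?_⟩
  rw [integral_finsetSum _ fun i _ => hi i]
  refine Finset.sum_congr rfl fun i _ => ?_
  rw [integral_indicator_const _ (hm i), smul_eq_mul, mul_comm]

theorem lintegral_comp_cell (L N : ℕ) (μ : Measure X) [IsFiniteMeasure μ] {ψ : ℕ → ℝ}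
    (hψ0 : ∀ i, 0 ≤ ψ i) (hψ : ∀ i, N ≤ i → ψ i = 0) :
    ∫⁻ x, ENNReal.ofReal (ψ (cell L x)) ∂μ =
      ENNReal.ofReal (∑ i ∈ Finset.range N, ψ i * μ.real (cell L ⁻¹' {i})) := by
  obtain ⟨h1, h2⟩ := integral_comp_cell L N μ hψ
  rw [← h2, ofReal_integral_eq_lintegral_ofReal h1 (ae_of_all _ fun x => hψ0 _)]

theorem lintegral_prod_comp_cell (L N : ℕ) (μ ν : Measure X) [IsFiniteMeasure μ]
    [IsFiniteMeasure ν] {ψ : ℕ → ℕ → ℝ} (hψ0 : ∀ i j, 0 ≤ ψ i j)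
    (hψ : ∀ i j, N ≤ i ∨ N ≤ j → ψ i j = 0) :
    ∫⁻ z, ENNReal.ofReal (ψ (cell L z.1) (cell L z.2)) ∂(μ.prod ν) =
      ENNReal.ofReal (∑ i ∈ Finset.range N, ∑ j ∈ Finset.range N,
        ψ i j * (μ.real (cell L ⁻¹' {i}) * ν.real (cell L ⁻¹' {j}))) := by
  have hm : Measurable fun z : X × X => ENNReal.ofReal (ψ (cell L z.1) (cell L z.2)) :=
    (measurable_of_countable fun ij : ℕ × ℕ => ENNReal.ofReal (ψ ij.1 ij.2)).comp
      (g := fun ij : ℕ × ℕ => ENNReal.ofReal (ψ ij.1 ij.2))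
      (f := fun z : X × X => (cell L z.1, cell L z.2))
      (((measurable_cell L).comp measurable_fst).prodMk ((measurable_cell L).comp measurable_snd))
  rw [lintegral_prod _ hm.aemeasurable]
  have h1 : ∀ x : X, ∫⁻ y, ENNReal.ofReal (ψ (cell L x) (cell L y)) ∂ν = ENNReal.ofReal
      ((fun i => ∑ j ∈ Finset.range N, ψ i j * ν.real (cell L ⁻¹' {j})) (cell L x)) := fun x =>
    lintegral_comp_cell L N ν (fun j => hψ0 _ j) fun j hj => hψ _ j (Or.inr hj)
  simp_rw [h1]
  rw [lintegral_comp_cell L N μ (ψ := fun i => ∑ j ∈ Finset.range N,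
      ψ i j * ν.real (cell L ⁻¹' {j}))
    (fun i => Finset.sum_nonneg fun j _ => mul_nonneg (hψ0 i j) measureReal_nonneg)
    (fun i hi => Finset.sum_eq_zero fun j _ => by rw [hψ i j (Or.inl hi), zero_mul])]
  congr 1
  refine Finset.sum_congr rfl fun i _ => ?_
  rw [Finset.sum_mul]
  exact Finset.sum_congr rfl fun j _ => by ring

theorem sum_cell_le (L N : ℕ) (μ : Measure X) [IsFiniteMeasure μ] :
    ∑ i ∈ Finset.range N, μ.real (cell L ⁻¹' {i}) ≤ μ.real univ := by
  rw [← measureReal_biUnion_finset]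
  · exact measureReal_mono (subset_univ _)
  · intro i _ j _ hij
    exact Disjoint.preimage _ (by simpa using hij)
  · exact fun i _ => measurable_cell L (measurableSet_singleton i)

theorem tendsto_sum_cell (L : ℕ) (μ : Measure X) [IsFiniteMeasure μ] :
    Filter.Tendsto (fun N => ∑ i ∈ Finset.range N, μ.real (cell L ⁻¹' {i})) Filter.atTop
      (nhds (μ.real univ)) := by
  have h1 : μ univ = ∑' i, μ (cell L ⁻¹' {i}) := by
    rw [← measure_iUnion]
    · congr 1
      ext x
      simp
    · intro i j hij
      exact Disjoint.preimage _ (by simpa using hij)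
    · exact fun i => measurable_cell L (measurableSet_singleton i)
  have h2 : ∑' i, μ (cell L ⁻¹' {i}) ≠ ∞ := h1 ▸ measure_ne_top μ univ
  have h3 := (ENNReal.hasSum_toReal h2).tendsto_sum_nat
  rw [← ENNReal.tsum_toReal_eq (ENNReal.ne_top_of_tsum_ne_top h2), ← h1] at h3
  exact h3

/-- Moving mass to the centre of its cell changes `F` by at most `1 / (L + 1)`; mass in the
discarded cells costs at most `1` per unit. -/
theorem abs_sum_cell_sub_integral_le (L N : ℕ) (μ : Measure X) [IsFiniteMeasure μ] {F : X → ℝ}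
    (hF : LipschitzWith 1 F) (hb : ∀ x, |F x| ≤ 1) :
    |∑ i ∈ Finset.range N, F (TopologicalSpace.denseSeq X i) * μ.real (cell L ⁻¹' {i}) -
      ∫ x, F x ∂μ| ≤ 1 / ((L : ℝ) + 1) * μ.real univ +
        (μ.real univ - ∑ i ∈ Finset.range N, μ.real (cell L ⁻¹' {i})) := by
  obtain ⟨h1, h2⟩ := integral_comp_cell L N μ
    (ψ := fun i => if i < N then F (TopologicalSpace.denseSeq X i) else 0)
    (fun i hi => if_neg hi.not_gt)
  obtain ⟨h3, h4⟩ := integral_comp_cell L N μ (ψ := fun i => if i < N then (1 : ℝ) else 0)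
    (fun i hi => if_neg hi.not_gt)
  have h5 : ∑ i ∈ Finset.range N, F (TopologicalSpace.denseSeq X i) * μ.real (cell L ⁻¹' {i}) =
      ∑ i ∈ Finset.range N, (if i < N then F (TopologicalSpace.denseSeq X i) else 0) *
        μ.real (cell L ⁻¹' {i}) :=
    Finset.sum_congr rfl fun i hi => by rw [if_pos (Finset.mem_range.1 hi)]
  have h6 : ∑ i ∈ Finset.range N, μ.real (cell L ⁻¹' {i}) =
      ∑ i ∈ Finset.range N, (if i < N then (1 : ℝ) else 0) * μ.real (cell L ⁻¹' {i}) :=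
    Finset.sum_congr rfl fun i hi => by rw [if_pos (Finset.mem_range.1 hi), one_mul]
  have hFi := integrable_of_lipschitzWith_of_abs_le hF hb μ
  rw [h5, h6, ← h2, ← h4, ← integral_sub h1 hFi]
  have h8 : Integrable (fun x => 1 - if cell L x < N then (1 : ℝ) else 0) μ :=
    (integrable_const _).sub h3
  have h9 : Integrable (fun x => 1 / ((L : ℝ) + 1) + (1 - if cell L x < N then (1 : ℝ) else 0))
    μ := (integrable_const _).add h8
  have h7 : 1 / ((L : ℝ) + 1) * μ.real univ +
      (μ.real univ - ∫ x, (if cell L x < N then (1 : ℝ) else 0) ∂μ) =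
      ∫ x, (1 / ((L : ℝ) + 1) + (1 - if cell L x < N then (1 : ℝ) else 0)) ∂μ := by
    rw [integral_add (integrable_const _) h8,
      integral_sub (integrable_const _) h3]
    simp [mul_comm]
  rw [h7]
  refine norm_integral_le_of_norm_le h9 (f := fun x =>
    (if cell L x < N then F (TopologicalSpace.denseSeq X (cell L x)) else 0) - F x) (ae_of_all _ fun x => ?_)
  rw [Real.norm_eq_abs]
  have hd := dist_cell_lt L x
  by_cases hx : cell L x < N
  · simp only [hx, if_true]
    have := hF.dist_le_mul (TopologicalSpace.denseSeq X (cell L x)) x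
    rw [Real.dist_eq, dist_comm _ x] at this
    simp only [NNReal.coe_one, one_mul] at this
    linarith
  · simp only [hx, if_false, zero_sub, abs_neg]
    have := hb x
    have : 0 < 1 / ((L : ℝ) + 1) := by positivity
    linarith

end Cells

section Plans

/-! ### Measurable choice of a nearly optimal partial transport plan -/

/-- The type of finite measures, with the `σ`-algebra generated by the evaluations. -/
abbrev FinMeas (X : Type*) [MeasurableSpace X] := {π : Measure X // IsFiniteMeasure π}

instance {X : Type*} [MeasurableSpace X] (π : FinMeas X) : IsFiniteMeasure π.1 := π.2

theorem measurable_finMeas_prod {X : Type*} [MeasurableSpace X] :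
    Measurable fun e : FinMeas X × FinMeas X => e.1.1.prod e.2.1 := by
  refine Measurable.measure_of_isPiSystem generateFrom_prod.symm isPiSystem_prod ?_ ?_
  · rintro _ ⟨s, hs, t, ht, rfl⟩
    simp only [Measure.prod_prod]
    exact ((Measure.measurable_coe hs).comp (measurable_subtype_coe.comp measurable_fst)).mul
      ((Measure.measurable_coe ht).comp (measurable_subtype_coe.comp measurable_snd))
  · simp only [← univ_prod_univ, Measure.prod_prod]
    exact ((Measure.measurable_coe .univ).comp (measurable_subtype_coe.comp measurable_fst)).mul
      ((Measure.measurable_coe .univ).comp (measurable_subtype_coe.comp measurable_snd))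

/-- Measurable selection from a countable family. -/
theorem exists_measurable_selection {E Z ι : Type*} [MeasurableSpace E] [MeasurableSpace Z]
    [Countable ι] (f : ι → E → Z) (hf : ∀ i, Measurable (f i)) (p : ι → E → Prop)
    (hp : ∀ i, MeasurableSet {e | p i e}) (hex : ∀ e, ∃ i, p i e) :
    ∃ s : E → Z, Measurable s ∧ ∀ e, ∃ i, p i e ∧ s e = f i e := by
  classical
  rcases isEmpty_or_nonempty E with hE | ⟨⟨e₀⟩⟩
  · exact ⟨fun e => hE.elim e, measurable_of_empty _, fun e => hE.elim e⟩
  have : Nonempty ι := ⟨(hex e₀).choose⟩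
  obtain ⟨enum, henum⟩ := exists_surjective_nat ι
  have hex' : ∀ e, ∃ n, p (enum n) e := fun e => by
    obtain ⟨i, hi⟩ := hex e
    obtain ⟨n, rfl⟩ := henum i
    exact ⟨n, hi⟩
  have hfind : Measurable fun e => Nat.find (hex' e) := measurable_find hex' fun n => hp _
  refine ⟨fun e => f (enum (Nat.find (hex' e))) e, ?_, fun e => ⟨_, Nat.find_spec (hex' e), rfl⟩⟩
  have h : Measurable fun q : ℕ × E => f (enum q.1) q.2 :=
    measurable_from_prod_countable_right fun n => hf (enum n)
  exact h.comp (hfind.prodMk measurable_id)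

variable {X : Type u} [MetricSpace X]

theorem exists_range_plan (N : ℕ) (a : ℕ → X) (p q : ℕ → ℝ)
    (hp : ∀ i, 0 ≤ p i) (hq : ∀ i, 0 ≤ q i) (W : ℝ)
    (hW : ∀ F : X → ℝ, LipschitzWith 1 F → (∀ x, |F x| ≤ 1) →
      ∑ i ∈ Finset.range N, F (a i) * (p i - q i) ≤ W) :
    ∃ g : ℕ → ℕ → ℝ, (∀ i j, 0 ≤ g i j) ∧ (∀ i < N, ∑ j ∈ Finset.range N, g i j ≤ p i) ∧
      (∀ j < N, ∑ i ∈ Finset.range N, g i j ≤ q j) ∧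
      ∑ i ∈ Finset.range N, ∑ j ∈ Finset.range N, g i j * dist (a i) (a j) +
        (∑ i ∈ Finset.range N, p i - ∑ i ∈ Finset.range N, ∑ j ∈ Finset.range N, g i j) +
        (∑ j ∈ Finset.range N, q j - ∑ i ∈ Finset.range N, ∑ j ∈ Finset.range N, g i j) ≤ W := by
  obtain ⟨g, hg0, hg1, hg2, hg3⟩ := exists_finite_plan (fun i : Fin N => a i) (fun i => p i)
    (fun i => q i) (fun i => hp _) (fun i => hq _) W (fun F hF hb => by
      have := hW F hF hb
      rwa [Finset.sum_range] at this)
  have key : ∀ i j : Fin N, (fun i j : ℕ => if h : i < N ∧ j < N then g ⟨i, h.1⟩ ⟨j, h.2⟩ else 0)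
      (i : ℕ) (j : ℕ) = g i j := fun i j => by simp
  refine ⟨fun i j => if h : i < N ∧ j < N then g ⟨i, h.1⟩ ⟨j, h.2⟩ else 0, ?_, ?_, ?_, ?_⟩
  · intro i j
    dsimp only
    split_ifs
    · exact hg0 _ _
    · exact le_rfl
  · intro i hi
    rw [Finset.sum_range]
    simpa only [key ⟨i, hi⟩] using hg1 ⟨i, hi⟩
  · intro j hj
    rw [Finset.sum_range]
    simpa only [key _ ⟨j, hj⟩] using hg2 ⟨j, hj⟩
  · simp only [Finset.sum_range]
    simp only [key]
    rw [Finset.sum_sub_distrib, Finset.sum_sub_distrib] at hg3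
    rw [Finset.sum_comm (f := fun j i => g i j)] at hg3
    exact hg3

variable [SecondCountableTopology X] [Nonempty X] [MeasurableSpace X] [BorelSpace X]

/-- The density, with respect to `π ⊗ π'`, of a discretised transport plan. -/
noncomputable def planDensity (c : (ℕ × ℕ →₀ ℕ) × ℕ) (i j : ℕ) : ℝ := c.1 (i, j) / (c.2 + 1 : ℝ)

/-- A discretised transport plan. -/
noncomputable def plan (c : (ℕ × ℕ →₀ ℕ) × ℕ) (e : FinMeas X × FinMeas X) : Measure (X × X) :=
  (e.1.1.prod e.2.1).withDensity fun z =>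
    ENNReal.ofReal (planDensity c (cell c.2 z.1) (cell c.2 z.2))

theorem planDensity_nonneg (c : (ℕ × ℕ →₀ ℕ) × ℕ) (i j : ℕ) : 0 ≤ planDensity c i j := by
  unfold planDensity; positivity

theorem measurable_planDensity (c : (ℕ × ℕ →₀ ℕ) × ℕ) : Measurable fun z : X × X =>
    ENNReal.ofReal (planDensity c (cell c.2 z.1) (cell c.2 z.2)) :=
  (measurable_of_countable fun ij : ℕ × ℕ => ENNReal.ofReal (planDensity c ij.1 ij.2)).comp
    (g := fun ij : ℕ × ℕ => ENNReal.ofReal (planDensity c ij.1 ij.2))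
    (f := fun z : X × X => (cell c.2 z.1, cell c.2 z.2))
    (((measurable_cell _).comp measurable_fst).prodMk ((measurable_cell _).comp measurable_snd))

theorem measurable_plan (c : (ℕ × ℕ →₀ ℕ) × ℕ) :
    Measurable (plan c : FinMeas X × FinMeas X → Measure (X × X)) := by
  refine Measure.measurable_of_measurable_coe _ fun s hs => ?_
  simp only [plan, withDensity_apply _ hs, ← lintegral_indicator hs]
  exact (Measure.measurable_lintegral ((measurable_planDensity c).indicator hs)).comp
    measurable_finMeas_prod

/-- The plan does not use more mass than available. -/
def PlanFeasible (c : (ℕ × ℕ →₀ ℕ) × ℕ) (e : FinMeas X × FinMeas X) : Prop :=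
  (∀ i, ∫⁻ y, ENNReal.ofReal (planDensity c i (cell c.2 y)) ∂e.2.1 ≤ 1) ∧
    ∀ j, ∫⁻ x, ENNReal.ofReal (planDensity c (cell c.2 x) j) ∂e.1.1 ≤ 1

theorem measurableSet_planFeasible (c : (ℕ × ℕ →₀ ℕ) × ℕ) :
    MeasurableSet {e : FinMeas X × FinMeas X | PlanFeasible c e} := by
  have h : ∀ w : ℕ → ℝ, Measurable fun x : X => ENNReal.ofReal (w (cell c.2 x)) := fun w =>
    (measurable_of_countable fun i => ENNReal.ofReal (w i)).comp (measurable_cell c.2)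
  refine MeasurableSet.inter (s₁ := {e | ∀ i, _}) (s₂ := {e | ∀ j, _}) ?_ ?_
  · rw [ofPred_forall]
    exact MeasurableSet.iInter fun i => measurableSet_le
      ((Measure.measurable_lintegral (h fun j => planDensity c i j)).comp
        (measurable_subtype_coe.comp measurable_snd)) measurable_const
  · rw [ofPred_forall]
    exact MeasurableSet.iInter fun j => measurableSet_le
      ((Measure.measurable_lintegral (h fun i => planDensity c i j)).comp
        (measurable_subtype_coe.comp measurable_fst)) measurable_const

/-- By Tonelli, the first marginal has a density with respect to `e.1`, and feasibility says that
this density is at most `1`. -/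
theorem PlanFeasible.fst_le {c : (ℕ × ℕ →₀ ℕ) × ℕ} {e : FinMeas X × FinMeas X}
    (h : PlanFeasible c e) : (plan c e).fst ≤ e.1.1 := by
  refine Measure.le_iff.2 fun s hs => ?_
  rw [Measure.fst_apply hs, plan, withDensity_apply _ (measurable_fst hs),
    ← lintegral_indicator (measurable_fst hs),
    lintegral_prod _ ((measurable_planDensity c).indicator (measurable_fst hs)).aemeasurable]
  calc _ ≤ ∫⁻ x, s.indicator 1 x ∂e.1.1 := lintegral_mono fun x => ?_
    _ = _ := lintegral_indicator_one hs
  by_cases hx : x ∈ s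
  · simpa [indicator, hx] using h.1 (cell c.2 x)
  · simp [indicator, hx]

theorem PlanFeasible.snd_le {c : (ℕ × ℕ →₀ ℕ) × ℕ} {e : FinMeas X × FinMeas X}
    (h : PlanFeasible c e) : (plan c e).snd ≤ e.2.1 := by
  refine Measure.le_iff.2 fun s hs => ?_
  rw [Measure.snd_apply hs, plan, withDensity_apply _ (measurable_snd hs),
    ← lintegral_indicator (measurable_snd hs), lintegral_prod_symm _
      ((measurable_planDensity c).indicator (measurable_snd hs)).aemeasurable]
  calc _ ≤ ∫⁻ x, s.indicator 1 x ∂e.2.1 := lintegral_mono fun x => ?_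
    _ = _ := lintegral_indicator_one hs
  by_cases hx : x ∈ s
  · simpa [indicator, hx] using h.2 (cell c.2 x)
  · simp [indicator, hx]

/-- The cost of a partial transport plan: transported mass pays the distance, the rest pays `1`. -/
noncomputable def transportCost (γ : Measure (X × X)) (π π' : Measure X) : ℝ≥0∞ :=
  ∫⁻ z, edist z.1 z.2 ∂γ + (π univ - γ univ) + (π' univ - γ univ)

end Plans

/-! ### Rounding of optimal plans and selection from a countable family -/

section NearOptimal

/-- Here `g` is the mass sent between cells of masses `p` and `q`, so `g / (p * q)` is its density
with respect to the product measure. Rounding it down to a multiple of `1 / n` preserves feasibility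
and loses at most `p * q / n`. Empty cells are harmless: there `g = 0` and division by zero gives
`0`. -/
theorem rounding_bounds {g p q n : ℝ} (hg : 0 ≤ g) (hp : 0 ≤ p) (hq : 0 ≤ q) (hgp : g ≤ p)
    (hgq : g ≤ q) (hn : 0 < n) :
    (⌊g / (p * q) * n⌋₊ : ℝ) / n * q ≤ g / p ∧ (⌊g / (p * q) * n⌋₊ : ℝ) / n * p ≤ g / q ∧
      (⌊g / (p * q) * n⌋₊ : ℝ) / n * (p * q) ≤ g ∧
      g ≤ (⌊g / (p * q) * n⌋₊ : ℝ) / n * (p * q) + 1 / n * (p * q) := by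
  rcases hp.eq_or_lt with rfl | hp'
  · have : g = 0 := le_antisymm hgp hg
    simp [this]
  rcases hq.eq_or_lt with rfl | hq'
  · have : g = 0 := le_antisymm hgq hg
    simp [this]
  have hpq : 0 < p * q := mul_pos hp' hq'
  have h1 : (⌊g / (p * q) * n⌋₊ : ℝ) / n ≤ g / (p * q) := by
    rw [div_le_iff₀ hn]
    exact Nat.floor_le (by positivity)
  have h2 : g / (p * q) ≤ (⌊g / (p * q) * n⌋₊ : ℝ) / n + 1 / n := by
    rw [← add_div, le_div_iff₀ hn]
    exact (Nat.lt_floor_add_one _).le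
  refine ⟨?_, ?_, ?_, ?_⟩
  · refine (mul_le_mul_of_nonneg_right h1 hq).trans_eq ?_
    field_simp
  · refine (mul_le_mul_of_nonneg_right h1 hp).trans_eq ?_
    field_simp
  · refine (mul_le_mul_of_nonneg_right h1 hpq.le).trans_eq ?_
    field_simp
  · rw [← add_mul, ← div_le_iff₀ hpq]
    exact h2

variable {X : Type u} [MetricSpace X] [SecondCountableTopology X] [Nonempty X] [MeasurableSpace X]
  [BorelSpace X]

/-- Restriction of a matrix to a finite square, as a finitely supported function. -/
noncomputable def squareFinsupp (N : ℕ) (m : ℕ → ℕ → ℕ) : ℕ × ℕ →₀ ℕ :=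
  Finsupp.onFinset (Finset.range N ×ˢ Finset.range N)
    (fun ij => if ij.1 < N ∧ ij.2 < N then m ij.1 ij.2 else 0) (by
      intro ij h
      by_contra h'
      exact h (if_neg (by simpa using h')))

theorem squareFinsupp_of_lt {N : ℕ} (m : ℕ → ℕ → ℕ) {i j : ℕ} (hi : i < N) (hj : j < N) :
    squareFinsupp N m (i, j) = m i j := by
  simp [squareFinsupp, hi, hj]

theorem squareFinsupp_of_le {N : ℕ} (m : ℕ → ℕ → ℕ) {i j : ℕ} (h : N ≤ i ∨ N ≤ j) :
    squareFinsupp N m (i, j) = 0 := by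
  simp only [squareFinsupp, Finsupp.onFinset_apply]
  exact if_neg (by omega)

theorem lintegral_edist_plan_le (N L : ℕ) (m : ℕ → ℕ → ℕ) (e : FinMeas X × FinMeas X) :
    ∫⁻ z, edist z.1 z.2 ∂(plan (squareFinsupp N m, L) e) ≤
      ENNReal.ofReal (∑ i ∈ Finset.range N, ∑ j ∈ Finset.range N,
        (planDensity (squareFinsupp N m, L) i j *
          (dist (TopologicalSpace.denseSeq X i) (TopologicalSpace.denseSeq X j) +
            2 * (1 / ((L : ℝ) + 1)))) *
          (e.1.1.real (cell L ⁻¹' {i}) * e.2.1.real (cell L ⁻¹' {j}))) := by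
  set c : (ℕ × ℕ →₀ ℕ) × ℕ := (squareFinsupp N m, L)
  have hr : (0 : ℝ) < 1 / ((L : ℝ) + 1) := by positivity
  rw [← lintegral_prod_comp_cell L N e.1.1 e.2.1 (ψ := fun i j => planDensity c i j *
    (dist (TopologicalSpace.denseSeq X i) (TopologicalSpace.denseSeq X j) +
      2 * (1 / ((L : ℝ) + 1))))
    (fun i j => mul_nonneg (planDensity_nonneg c i j)
      (add_nonneg dist_nonneg (by positivity)))
    (fun i j h => by simp [planDensity, c, squareFinsupp_of_le m h])]
  rw [plan, lintegral_withDensity_eq_lintegral_mul _ (measurable_planDensity c) (by fun_prop)]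
  refine lintegral_mono fun z => ?_
  rw [Pi.mul_apply, edist_dist, ← ENNReal.ofReal_mul (planDensity_nonneg c _ _)]
  refine ENNReal.ofReal_le_ofReal (mul_le_mul_of_nonneg_left ?_ (planDensity_nonneg c _ _))
  have h1 := dist_cell_lt L z.1
  have h2 := dist_cell_lt L z.2
  have h3 := dist_triangle4 z.1 (TopologicalSpace.denseSeq X (cell L z.1))
    (TopologicalSpace.denseSeq X (cell L z.2)) z.2
  rw [dist_comm] at h2
  change _ ≤ dist (TopologicalSpace.denseSeq X (cell L z.1))
    (TopologicalSpace.denseSeq X (cell L z.2)) + _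
  linarith

theorem plan_univ (N L : ℕ) (m : ℕ → ℕ → ℕ) (e : FinMeas X × FinMeas X) :
    plan (squareFinsupp N m, L) e univ =
      ENNReal.ofReal (∑ i ∈ Finset.range N, ∑ j ∈ Finset.range N,
        planDensity (squareFinsupp N m, L) i j *
          (e.1.1.real (cell L ⁻¹' {i}) * e.2.1.real (cell L ⁻¹' {j}))) := by
  rw [plan, withDensity_apply _ MeasurableSet.univ, Measure.restrict_univ]
  exact lintegral_prod_comp_cell L N e.1.1 e.2.1 (planDensity_nonneg _)
    (fun i j h => by simp [planDensity, squareFinsupp_of_le m h])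

theorem planFeasible_squareFinsupp (N L : ℕ) (m : ℕ → ℕ → ℕ) (e : FinMeas X × FinMeas X)
    (hrow : ∀ i < N, ∑ j ∈ Finset.range N, (m i j : ℝ) / (L + 1) *
      e.2.1.real (cell L ⁻¹' {j}) ≤ 1)
    (hcol : ∀ j < N, ∑ i ∈ Finset.range N, (m i j : ℝ) / (L + 1) *
      e.1.1.real (cell L ⁻¹' {i}) ≤ 1) :
    PlanFeasible (squareFinsupp N m, L) e := by
  constructor
  · intro i
    rw [lintegral_comp_cell L N e.2.1 (planDensity_nonneg _ i)
      (fun j hj => by simp [planDensity, squareFinsupp_of_le m (Or.inr hj)]),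
      ENNReal.ofReal_le_one]
    rcases lt_or_ge i N with hi | hi
    · refine le_trans (Finset.sum_le_sum fun j hj => ?_) (hrow i hi)
      rw [planDensity, squareFinsupp_of_lt m hi (Finset.mem_range.1 hj)]
    · simp [planDensity, squareFinsupp_of_le m (Or.inl hi)]
  · intro j
    rw [lintegral_comp_cell L N e.1.1 (ψ := fun i => planDensity (squareFinsupp N m, L) i j)
      (fun i => planDensity_nonneg _ i j)
      (fun i hi => by simp [planDensity, squareFinsupp_of_le m (Or.inl hi)]),
      ENNReal.ofReal_le_one]
    rcases lt_or_ge j N with hj | hj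
    · refine le_trans (Finset.sum_le_sum fun i hi => ?_) (hcol j hj)
      rw [planDensity, squareFinsupp_of_lt m (Finset.mem_range.1 hi) hj]
    · simp [planDensity, squareFinsupp_of_le m (Or.inr hj)]

/-- Up to an arbitrarily small error, the distance `‖π - π'‖₁` is the cost of a discretised
transport plan. -/
theorem exists_transportCost_plan_le (e : FinMeas X × FinMeas X) {δ : ℝ} (hδ : 0 < δ) :
    ∃ c, PlanFeasible c e ∧ transportCost (plan c e) e.1.1 e.2.1 ≤
      wasserstein e.1.1 e.2.1 + ENNReal.ofReal δ := by
  set M := e.1.1.real univ with hM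
  set M' := e.2.1.real univ with hM'
  have hM0 : 0 ≤ M := measureReal_nonneg
  have hM0' : 0 ≤ M' := measureReal_nonneg
  -- One integer `L` fixes both the cell radius `r` and the denominators of the densities. The
  -- errors are `r M + r M'` from discretising test functions, `2 r M` from distances within cells
  -- and `2 r M M'` from rounding, which counts in both unmatched masses: half of `δ` in total.
  obtain ⟨L, hL⟩ := exists_nat_one_div_lt (div_pos hδ
    (by positivity : (0 : ℝ) < 2 * (3 * M + M' + 2 * (M * M') + 1)))
  set r : ℝ := 1 / ((L : ℝ) + 1) with hr
  have hr0 : 0 < r := by positivity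
  have hL1 : (0 : ℝ) < (L : ℝ) + 1 := by positivity
  have hrδ : r * (3 * M + M' + 2 * (M * M')) ≤ δ / 2 := by
    rw [lt_div_iff₀ (by positivity)] at hL
    nlinarith
  set p : ℕ → ℝ := fun i => e.1.1.real (cell L ⁻¹' {i}) with hp
  set q : ℕ → ℝ := fun i => e.2.1.real (cell L ⁻¹' {i}) with hq
  have hp0 : ∀ i, 0 ≤ p i := fun i => measureReal_nonneg
  have hq0 : ∀ i, 0 ≤ q i := fun i => measureReal_nonneg
  -- The other half of `δ`: each tail is below `δ / 8` and is paid twice, in the test function bound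
  -- and as unmatched mass.
  obtain ⟨N, hN, hN'⟩ := (((tendsto_sum_cell L e.1.1).eventually
    (lt_mem_nhds (show M - δ / 8 < M by linarith))).and ((tendsto_sum_cell L e.2.1).eventually
    (lt_mem_nhds (show M' - δ / 8 < M' by linarith)))).exists
  have hpM : ∑ i ∈ Finset.range N, p i ≤ M := sum_cell_le L N e.1.1
  have hqM : ∑ i ∈ Finset.range N, q i ≤ M' := sum_cell_le L N e.2.1
  obtain ⟨g, hg0, hg1, hg2, hg3⟩ := exists_range_plan N (TopologicalSpace.denseSeq X) p q hp0 hq0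
    ((wasserstein e.1.1 e.2.1).toReal + r * M + r * M' + δ / 4) (by
      intro F hF hb
      have h1 := abs_le.1 (abs_sum_cell_sub_integral_le L N e.1.1 hF hb)
      have h2 := abs_le.1 (abs_sum_cell_sub_integral_le L N e.2.1 hF hb)
      have h3 := integral_sub_integral_le_toReal_wasserstein (μ := e.1.1) (ν := e.2.1) hF hb
      simp only [mul_sub, Finset.sum_sub_distrib]
      simp only [← hr, ← hM, ← hM'] at h1 h2
      linarith [h1.2, h2.1])
  have hgp : ∀ i < N, ∀ j < N, g i j ≤ p i := fun i hi j hj =>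
    (Finset.single_le_sum (f := fun j => g i j) (fun j _ => hg0 i j)
      (Finset.mem_range.2 hj)).trans (hg1 i hi)
  have hgq : ∀ i < N, ∀ j < N, g i j ≤ q j := fun i hi j hj =>
    (Finset.single_le_sum (f := fun i => g i j) (fun i _ => hg0 i j)
      (Finset.mem_range.2 hi)).trans (hg2 j hj)
  set m : ℕ → ℕ → ℕ := fun i j => ⌊g i j / (p i * q j) * ((L : ℝ) + 1)⌋₊ with hm
  have hround := fun i (hi : i < N) j (hj : j < N) => rounding_bounds (hg0 i j) (hp0 i) (hq0 j)
    (hgp i hi j hj) (hgq i hi j hj) hL1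
  set B := ∑ i ∈ Finset.range N, ∑ j ∈ Finset.range N,
    (m i j : ℝ) / ((L : ℝ) + 1) * (p i * q j) with hB
  set G := ∑ i ∈ Finset.range N, ∑ j ∈ Finset.range N, g i j with hG
  have hBG : B ≤ G := Finset.sum_le_sum fun i hi => Finset.sum_le_sum fun j hj =>
    (hround i (Finset.mem_range.1 hi) j (Finset.mem_range.1 hj)).2.2.1
  have hGB : G ≤ B + r * (M * M') := by
    have h1 : G ≤ ∑ i ∈ Finset.range N, ∑ j ∈ Finset.range N,
        ((m i j : ℝ) / ((L : ℝ) + 1) * (p i * q j) + r * (p i * q j)) :=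
      Finset.sum_le_sum fun i hi => Finset.sum_le_sum fun j hj =>
        (hround i (Finset.mem_range.1 hi) j (Finset.mem_range.1 hj)).2.2.2
    have h2 : ∑ i ∈ Finset.range N, ∑ j ∈ Finset.range N, p i * q j ≤ M * M' := by
      rw [← Finset.sum_mul_sum]
      exact mul_le_mul hpM hqM (Finset.sum_nonneg fun i _ => hq0 i) hM0
    simp only [Finset.sum_add_distrib, ← Finset.mul_sum] at h1 h2
    have h3 := mul_le_mul_of_nonneg_left h2 hr0.le
    simp only [hB]
    linarith
  have hGp : G ≤ ∑ i ∈ Finset.range N, p i := Finset.sum_le_sum fun i hi =>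
    hg1 i (Finset.mem_range.1 hi)
  have hGq : G ≤ ∑ i ∈ Finset.range N, q i := by
    rw [hG, Finset.sum_comm]
    exact Finset.sum_le_sum fun j hj => hg2 j (Finset.mem_range.1 hj)
  have hB0 : 0 ≤ B := Finset.sum_nonneg fun i _ => Finset.sum_nonneg fun j _ => by
    have := hp0 i
    have := hq0 j
    positivity
  refine ⟨(squareFinsupp N m, L), planFeasible_squareFinsupp N L m e ?_ ?_, ?_⟩
  · intro i hi
    calc _ ≤ ∑ j ∈ Finset.range N, g i j / p i := Finset.sum_le_sum fun j hj =>
          (hround i hi j (Finset.mem_range.1 hj)).1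
      _ ≤ 1 := by
        rw [← Finset.sum_div]
        exact div_le_one_of_le₀ (hg1 i hi) (hp0 i)
  · intro j hj
    calc _ ≤ ∑ i ∈ Finset.range N, g i j / q j := Finset.sum_le_sum fun i hi =>
          (hround i (Finset.mem_range.1 hi) j hj).2.1
      _ ≤ 1 := by
        rw [← Finset.sum_div]
        exact div_le_one_of_le₀ (hg2 j hj) (hq0 j)
  have hpl : ∀ i ∈ Finset.range N, ∀ j ∈ Finset.range N,
      planDensity (squareFinsupp N m, L) i j = (m i j : ℝ) / ((L : ℝ) + 1) := fun i hi j hj => by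
    rw [planDensity, squareFinsupp_of_lt m (Finset.mem_range.1 hi) (Finset.mem_range.1 hj)]
  have hu : plan (squareFinsupp N m, L) e univ = ENNReal.ofReal B := by
    rw [plan_univ]
    congr 1
    exact Finset.sum_congr rfl fun i hi => Finset.sum_congr rfl fun j hj => by rw [hpl i hi j hj]
  have hd : ∫⁻ z, edist z.1 z.2 ∂(plan (squareFinsupp N m, L) e) ≤ ENNReal.ofReal
      (∑ i ∈ Finset.range N, ∑ j ∈ Finset.range N, g i j *
        dist (TopologicalSpace.denseSeq X i) (TopologicalSpace.denseSeq X j) + 2 * r * M) := by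
    refine (lintegral_edist_plan_le N L m e).trans (ENNReal.ofReal_le_ofReal ?_)
    have h1 : 2 * r * G ≤ 2 * r * M := mul_le_mul_of_nonneg_left (hGp.trans hpM) (by positivity)
    refine le_trans ?_ (add_le_add_right h1 _)
    rw [hG, Finset.mul_sum, ← Finset.sum_add_distrib]
    refine Finset.sum_le_sum fun i hi => ?_
    rw [Finset.mul_sum, ← Finset.sum_add_distrib]
    refine Finset.sum_le_sum fun j hj => ?_
    rw [hpl i hi j hj]
    have h2 := (hround i (Finset.mem_range.1 hi) j (Finset.mem_range.1 hj)).2.2.1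
    have h3 : 0 ≤ dist (TopologicalSpace.denseSeq X i) (TopologicalSpace.denseSeq X j) + 2 * r :=
      add_nonneg dist_nonneg (by positivity)
    have h4 := mul_le_mul_of_nonneg_right h2 h3
    rw [← hr]
    change (m i j : ℝ) / ((L : ℝ) + 1) * (p i * q j) * _ ≤ _ at h4
    linarith
  have hS : 0 ≤ ∑ i ∈ Finset.range N, ∑ j ∈ Finset.range N, g i j *
      dist (TopologicalSpace.denseSeq X i) (TopologicalSpace.denseSeq X j) :=
    Finset.sum_nonneg fun i _ => Finset.sum_nonneg fun j _ => mul_nonneg (hg0 i j) dist_nonneg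
  rw [transportCost, hu, ← ofReal_measureReal (μ := e.1.1), ← ofReal_measureReal (μ := e.2.1),
    ← ENNReal.ofReal_sub _ hB0, ← ENNReal.ofReal_sub _ hB0,
    ← ENNReal.ofReal_toReal (wasserstein_ne_top e.1.1 e.2.1),
    ← ENNReal.ofReal_add ENNReal.toReal_nonneg hδ.le, ← hM, ← hM']
  refine (add_le_add_left (add_le_add_left hd _) _).trans ?_
  rw [← ENNReal.ofReal_add (by positivity) (by linarith),
    ← ENNReal.ofReal_add (add_nonneg (by positivity) (by linarith)) (by linarith)]
  refine ENNReal.ofReal_le_ofReal ?_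
  change M - δ / 8 < ∑ i ∈ Finset.range N, p i at hN
  change M' - δ / 8 < ∑ i ∈ Finset.range N, q i at hN'
  linarith

/-- A nearly optimal partial transport plan depending measurably on the two measures. -/
theorem exists_measurable_plan {δ : ℝ} (hδ : 0 < δ) :
    ∃ γ : FinMeas X × FinMeas X → Measure (X × X), Measurable γ ∧ ∀ e,
      (γ e).fst ≤ e.1.1 ∧ (γ e).snd ≤ e.2.1 ∧
      transportCost (γ e) e.1.1 e.2.1 ≤ wasserstein e.1.1 e.2.1 + ENNReal.ofReal δ := by
  classical
  -- The value `∞` excludes infeasible plans from the infimum.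
  let cost : (ℕ × ℕ →₀ ℕ) × ℕ → FinMeas X × FinMeas X → ℝ≥0∞ := fun c e =>
    if PlanFeasible c e then transportCost (plan c e) e.1.1 e.2.1 else ∞
  have hcost : ∀ c, Measurable (cost c) := by
    intro c
    refine Measurable.ite (measurableSet_planFeasible c) ?_ measurable_const
    have h1 : Measurable fun e : FinMeas X × FinMeas X => plan c e univ :=
      (Measure.measurable_coe .univ).comp (measurable_plan c)
    have h2 : Measurable fun e : FinMeas X × FinMeas X => e.1.1 univ :=
      (Measure.measurable_coe .univ).comp (measurable_subtype_coe.comp measurable_fst)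
    have h3 : Measurable fun e : FinMeas X × FinMeas X => e.2.1 univ :=
      (Measure.measurable_coe .univ).comp (measurable_subtype_coe.comp measurable_snd)
    have h4 : Measurable fun e : FinMeas X × FinMeas X => ∫⁻ z, edist z.1 z.2 ∂(plan c e) :=
      (Measure.measurable_lintegral (by fun_prop)).comp (measurable_plan c)
    exact (h4.add (h2.sub h1)).add (h3.sub h1)
  have hinf : ∀ e, ⨅ c, cost c e ≤ wasserstein e.1.1 e.2.1 := by
    intro e
    refine ENNReal.le_of_forall_pos_le_add fun η hη _ => ?_
    obtain ⟨c, hc1, hc2⟩ := exists_transportCost_plan_le e (δ := η) (by exact_mod_cast hη)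
    refine (iInf_le _ c).trans ?_
    simp only [cost, if_pos hc1]
    simpa using hc2
  have hfin : ∀ e, ⨅ c, cost c e < ∞ := fun e =>
    (hinf e).trans_lt (wasserstein_ne_top e.1.1 e.2.1).lt_top
  -- The cost is compared with the infimum over the countable family, which is measurable, so
  -- measurability of `wasserstein` as a supremum over test functions is never needed.
  obtain ⟨γ, hγ, hγ'⟩ := exists_measurable_selection plan measurable_plan
    (fun c e => cost c e < (⨅ c, cost c e) + ENNReal.ofReal δ)
    (fun c => measurableSet_lt (hcost c) ((Measurable.iInf hcost).add measurable_const))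
    (fun e => iInf_lt_iff.1 (ENNReal.lt_add_right (hfin e).ne
      (ENNReal.ofReal_pos.2 hδ).ne'))
  refine ⟨γ, hγ, fun e => ?_⟩
  obtain ⟨c, hc, he⟩ := hγ' e
  have hf : PlanFeasible c e := by
    by_contra h
    simp only [cost, if_neg h] at hc
    exact absurd hc (by simp)
  simp only [cost, if_pos hf] at hc
  rw [he]
  exact ⟨hf.fst_le, hf.snd_le, hc.le.trans (add_le_add_left (hinf e) _)⟩

end NearOptimal

section PoissonCoupling

/-! ### Coupling of two Poisson point processes -/

variable {X : Type u} [MeasurableSpace X]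

/-- A point configuration charging `s` has mass at least `1` there, so Markov's inequality and the
mean measure give the bound. -/
theorem poissonPointProcess_ne_zero_le (π : Measure X)
    [IsFiniteMeasure π] {s : Set X} (hs : MeasurableSet s) :
    poissonPointProcess π {η | η s ≠ 0} ≤ π s := by
  have hm : MeasurableSet {η : Measure X | η s = 0 ∨ 1 ≤ η s} :=
    (measurableSet_eq_fun (Measure.measurable_coe hs) measurable_const).union
      (measurableSet_le measurable_const (Measure.measurable_coe hs))
  have hae : ∀ᵐ η ∂(poissonPointProcess π), η s = 0 ∨ 1 ≤ η s := by
    rw [poissonPointProcess_eq, Measure.ae_sum_iff' hm]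
    intro k
    refine Measure.ae_smul_measure ?_ _
    rw [pointSumLaw, ae_map_iff (measurable_sum_dirac k).aemeasurable hm]
    refine ae_of_all _ fun y => ?_
    by_cases h : ∃ i, y i ∈ s
    · obtain ⟨i, hi⟩ := h
      right
      rw [Measure.finsetSum_apply]
      refine le_trans ?_ (Finset.single_le_sum (f := fun i => Measure.dirac (y i) s)
        (fun _ _ => zero_le) (Finset.mem_univ i))
      simp [Measure.dirac_apply' _ hs, hi]
    · left
      push Not at h
      simp [Measure.finsetSum_apply, Measure.dirac_apply' _ hs, h]
  rw [← lintegral_poissonPointProcess_apply π hs]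
  calc poissonPointProcess π {η | η s ≠ 0} ≤ poissonPointProcess π {η | 1 ≤ η s} := by
        refine measure_mono_ae ?_
        filter_upwards [hae] with η hη h
        exact hη.resolve_left h
    _ ≤ _ := by
      simpa using mul_meas_ge_le_lintegral (μ := poissonPointProcess π)
        (Measure.measurable_coe hs) 1

/-- Superposition of the two marginals of a configuration of pairs with two configurations. -/
noncomputable def superpose (w : Measure (X × X) × Measure X × Measure X) :
    Measure X × Measure X := (w.1.map Prod.fst + w.2.1, w.1.map Prod.snd + w.2.2)

theorem measurable_superpose : Measurable (superpose (X := X)) := by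
  have h1 : Measurable fun w : Measure (X × X) × Measure X × Measure X => w.1.map Prod.fst :=
    (Measure.measurable_map _ measurable_fst).comp measurable_fst
  have h2 : Measurable fun w : Measure (X × X) × Measure X × Measure X => w.1.map Prod.snd :=
    (Measure.measurable_map _ measurable_snd).comp measurable_fst
  exact (h1.add (by fun_prop)).prodMk (h2.add (by fun_prop))

/-- The law of the coupling of Poisson point processes built from a partial transport plan. -/
noncomputable def planCoupling (γ : Measure (X × X)) (ρ ρ' : Measure X) :
    Measure (Measure X × Measure X) :=
  ((poissonPointProcess γ).prod ((poissonPointProcess ρ).prod (poissonPointProcess ρ'))).map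
    superpose

/-- The projected pairs form a Poisson process with intensity `γ.fst`, independent of the added one;
superposition adds the intensities. -/
theorem planCoupling_fst (γ : Measure (X × X)) (ρ ρ' : Measure X) [IsFiniteMeasure γ]
    [IsFiniteMeasure ρ] :
    (planCoupling γ ρ ρ').map Prod.fst = poissonPointProcess (γ.fst + ρ) := by
  have hadd : Measurable fun p : Measure X × Measure X => p.1 + p.2 := by fun_prop
  have hf : Measurable (Measure.map (Prod.fst : X × X → X)) :=
    Measure.measurable_map _ measurable_fst
  have h := Measure.map_fst_prod (μ := poissonPointProcess ρ) (ν := poissonPointProcess ρ')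
  rw [measure_univ, one_smul] at h
  rw [poissonPointProcess_add, Measure.conv, Measure.fst, poissonPointProcess_map γ measurable_fst,
    planCoupling, Measure.map_map measurable_fst measurable_superpose]
  conv_rhs => rw [← h]
  rw [Measure.map_prod_map _ _ hf measurable_fst,
    Measure.map_map hadd (hf.prodMap measurable_fst)]
  rfl

theorem planCoupling_snd (γ : Measure (X × X)) (ρ ρ' : Measure X) [IsFiniteMeasure γ]
    [IsFiniteMeasure ρ'] :
    (planCoupling γ ρ ρ').map Prod.snd = poissonPointProcess (γ.snd + ρ') := by
  have hadd : Measurable fun p : Measure X × Measure X => p.1 + p.2 := by fun_prop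
  have hf : Measurable (Measure.map (Prod.snd : X × X → X)) :=
    Measure.measurable_map _ measurable_snd
  have h := Measure.map_snd_prod (μ := poissonPointProcess ρ) (ν := poissonPointProcess ρ')
  rw [measure_univ, one_smul] at h
  rw [poissonPointProcess_add, Measure.conv, Measure.snd, poissonPointProcess_map γ measurable_snd,
    planCoupling, Measure.map_map measurable_snd measurable_superpose]
  conv_rhs => rw [← h]
  rw [Measure.map_prod_map _ _ hf measurable_snd,
    Measure.map_map hadd (hf.prodMap measurable_snd)]
  rfl

open Classical in
/-- Replaces measures of infinite mass by zero. -/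
noncomputable def finPart (π : Measure X) : FinMeas X :=
  if h : IsFiniteMeasure π then ⟨π, h⟩ else ⟨0, inferInstance⟩

theorem finPart_of_isFiniteMeasure (π : Measure X)
    [h : IsFiniteMeasure π] : (finPart π).1 = π := by
  rw [finPart, dif_pos h]

theorem measurable_finPart : Measurable (finPart : Measure X → FinMeas X) := by
  classical
  have h : (fun π : Measure X => (finPart π).1) =
      fun π => if IsFiniteMeasure π then π else 0 := by
    funext π
    unfold finPart
    split_ifs <;> rfl
  refine (MeasurableEmbedding.subtype_coe measurableSet_isFiniteMeasure).measurable_comp_iff.1 ?_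
  change Measurable fun π : Measure X => (finPart π).1
  rw [h]
  exact Measurable.ite measurableSet_isFiniteMeasure measurable_id measurable_const

/-- Infinite intensities were given the law `δ_0`, which is also the Poisson law of intensity zero.
A coupling kernel on finite measures therefore extends to all measures with correct marginals. -/
theorem poissonPointProcess_finPart (π : Measure X) :
    poissonPointProcess (finPart π).1 = poissonPointProcess π := by
  by_cases h : IsFiniteMeasure π
  · rw [finPart_of_isFiniteMeasure]
  · rw [finPart, dif_neg h, poissonPointProcess_zero,
      poissonPointProcess_of_not_isFiniteMeasure h]

end PoissonCoupling

/-! ### Expected distance under the Poisson coupling -/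

section WassersteinCoupling

variable {X : Type u} [MetricSpace X] [SecondCountableTopology X] [MeasurableSpace X] [BorelSpace X]

/-- A matched pair changes the integral of a test function by at most its distance, an unmatched
point by at most `1`. -/
theorem wasserstein_superpose_le (hd : ∀ x y : X, dist x y ≤ 1) (N : Measure (X × X))
    (l l' : Measure X) [IsFiniteMeasure N] [IsFiniteMeasure l] [IsFiniteMeasure l'] :
    wasserstein (superpose (N, l, l')).1 (superpose (N, l, l')).2 ≤
      ∫⁻ z, edist z.1 z.2 ∂N + l univ + l' univ := by
  have hdi : Integrable (fun z : X × X => dist z.1 z.2) N :=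
    Integrable.of_bound (by fun_prop) 1 (ae_of_all _ fun z => by
      rw [Real.norm_of_nonneg dist_nonneg]; exact hd _ _)
  have hed : ∫⁻ z, edist z.1 z.2 ∂N = ENNReal.ofReal (∫ z, dist z.1 z.2 ∂N) := by
    rw [ofReal_integral_eq_lintegral_ofReal hdi (ae_of_all _ fun z => dist_nonneg)]
    simp only [edist_dist]
  rw [hed, ← ofReal_measureReal (μ := l), ← ofReal_measureReal (μ := l'),
    ← ENNReal.ofReal_add (integral_nonneg fun z => dist_nonneg) measureReal_nonneg,
    ← ENNReal.ofReal_add (add_nonneg (integral_nonneg fun z => dist_nonneg) measureReal_nonneg)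
      measureReal_nonneg]
  refine wasserstein_le_ofReal fun F hF hb => ?_
  have hi : ∀ (μ : Measure X) [IsFiniteMeasure μ], Integrable F μ := fun μ _ =>
    integrable_of_lipschitzWith_of_abs_le hF hb μ
  have hm : ∀ μ : Measure X, AEStronglyMeasurable F μ := fun μ =>
    hF.continuous.aestronglyMeasurable
  simp only [superpose]
  rw [integral_add_measure (hi _) (hi _), integral_add_measure (hi _) (hi _),
    integral_map (by fun_prop) (hm _), integral_map (by fun_prop) (hm _)]
  have h1 := abs_le.1 (abs_integral_le hb l)
  have h2 := abs_le.1 (abs_integral_le hb l')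
  have h3 : ∫ z, F z.1 ∂N - ∫ z, F z.2 ∂N ≤ ∫ z, dist z.1 z.2 ∂N := by
    have h4 : Integrable (fun z : X × X => F z.1) N := (hi (N.map Prod.fst)).comp_measurable
      measurable_fst
    have h5 : Integrable (fun z : X × X => F z.2) N := (hi (N.map Prod.snd)).comp_measurable
      measurable_snd
    rw [← integral_sub h4 h5]
    refine integral_mono (h4.sub h5) hdi fun z => ?_
    have := hF.dist_le_mul z.1 z.2
    rw [Real.dist_eq, NNReal.coe_one, one_mul] at this
    exact (le_abs_self _).trans this
  linarith

/-- Campbell's formula integrates the three terms of the pathwise bound. The integral of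
`wasserstein`, whose measurability is not established, is only bounded above, for which
`lintegral_map_le` suffices. -/
theorem lintegral_wasserstein_planCoupling_le (hd : ∀ x y : X, dist x y ≤ 1)
    (γ : Measure (X × X)) (ρ ρ' : Measure X) [IsFiniteMeasure γ] [IsFiniteMeasure ρ]
    [IsFiniteMeasure ρ'] :
    ∫⁻ p, wasserstein p.1 p.2 ∂(planCoupling γ ρ ρ') ≤
      ∫⁻ z, edist z.1 z.2 ∂γ + ρ univ + ρ' univ := by
  set ν := (poissonPointProcess γ).prod
    ((poissonPointProcess ρ).prod (poissonPointProcess ρ')) with hν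
  have hm1 : Measurable fun N : Measure (X × X) => ∫⁻ z, edist z.1 z.2 ∂N :=
    Measure.measurable_lintegral (by fun_prop)
  have hm2 : Measurable fun l : Measure X => l univ := Measure.measurable_coe .univ
  have q1 : Measure.QuasiMeasurePreserving Prod.fst ν (poissonPointProcess γ) :=
    Measure.quasiMeasurePreserving_fst
  have q2 : Measure.QuasiMeasurePreserving Prod.snd ν
      ((poissonPointProcess ρ).prod (poissonPointProcess ρ')) :=
    Measure.quasiMeasurePreserving_snd
  have hle : ∀ᵐ w ∂ν, wasserstein (superpose w).1 (superpose w).2 ≤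
      ∫⁻ z, edist z.1 z.2 ∂w.1 + w.2.1 univ + w.2.2 univ := by
    filter_upwards [q1.ae (ae_isFiniteMeasure_poissonPointProcess γ),
      q2.ae (Measure.quasiMeasurePreserving_fst.ae (ae_isFiniteMeasure_poissonPointProcess ρ)),
      q2.ae (Measure.quasiMeasurePreserving_snd.ae (ae_isFiniteMeasure_poissonPointProcess ρ'))]
      with w h1 h2 h3
    exact wasserstein_superpose_le hd w.1 w.2.1 w.2.2
  calc ∫⁻ p, wasserstein p.1 p.2 ∂(planCoupling γ ρ ρ') ≤
        ∫⁻ w, wasserstein (superpose w).1 (superpose w).2 ∂ν :=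
          lintegral_map_le (fun p : Measure X × Measure X => wasserstein p.1 p.2) superpose
    _ ≤ ∫⁻ w, (∫⁻ z, edist z.1 z.2 ∂w.1 + w.2.1 univ + w.2.2 univ) ∂ν := lintegral_mono_ae hle
    _ = ∫⁻ z, edist z.1 z.2 ∂γ + ρ univ + ρ' univ := by
      have m1 : Measurable fun w : Measure (X × X) × Measure X × Measure X =>
          ∫⁻ z, edist z.1 z.2 ∂w.1 := hm1.comp measurable_fst
      have m2 : Measurable fun w : Measure (X × X) × Measure X × Measure X => w.2.1 univ :=
        hm2.comp (measurable_fst.comp measurable_snd)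
      have m3 : Measurable fun w : Measure (X × X) × Measure X × Measure X => w.2.2 univ :=
        hm2.comp (measurable_snd.comp measurable_snd)
      have m4 : Measurable fun w : Measure X × Measure X => w.1 univ := hm2.comp measurable_fst
      have m5 : Measurable fun w : Measure X × Measure X => w.2 univ := hm2.comp measurable_snd
      rw [lintegral_add_right _ m3, lintegral_add_right _ m2]
      congr 1
      · congr 1
        · rw [hν, lintegral_prod _ m1.aemeasurable]
          simp only [lintegral_const, measure_univ, mul_one]
          exact lintegral_poissonPointProcess γ (by fun_prop)
        · rw [hν, lintegral_prod _ m2.aemeasurable]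
          simp only [lintegral_const, measure_univ, mul_one]
          rw [lintegral_prod _ m4.aemeasurable]
          simp only [lintegral_const, measure_univ, mul_one]
          exact lintegral_poissonPointProcess_apply ρ .univ
      · rw [hν, lintegral_prod _ m3.aemeasurable]
        simp only [lintegral_const, measure_univ, mul_one]
        rw [lintegral_prod _ m5.aemeasurable]
        simp only [lintegral_const, measure_univ, mul_one]
        exact lintegral_poissonPointProcess_apply ρ' .univ

/-- Poisson point processes can be coupled, measurably in their intensities, in such a way that
their expected distance is at most the distance of the intensities, up to an arbitrarily small
error. -/
theorem exists_poisson_coupling [Nonempty X] (hd : ∀ x y : X, dist x y ≤ 1) {δ : ℝ} (hδ : 0 < δ) :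
    ∃ κ : Kernel (Measure X × Measure X) (Measure X × Measure X), ∀ e,
      (κ e).map Prod.fst = poissonPointProcess e.1 ∧
      (κ e).map Prod.snd = poissonPointProcess e.2 ∧
      (IsFiniteMeasure e.1 → IsFiniteMeasure e.2 →
        ∫⁻ p, wasserstein p.1 p.2 ∂(κ e) ≤ wasserstein e.1 e.2 + ENNReal.ofReal δ) := by
  obtain ⟨γ, hγ, hγ'⟩ := exists_measurable_plan (X := X) hδ
  have hfst : ∀ e, IsFiniteMeasure (γ e).fst := fun e =>
    isFiniteMeasure_of_le e.1.1 (hγ' e).1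
  have hsnd : ∀ e, IsFiniteMeasure (γ e).snd := fun e =>
    isFiniteMeasure_of_le e.2.1 (hγ' e).2.1
  have hfin : ∀ e, IsFiniteMeasure (γ e) := fun e =>
    ⟨by rw [← Measure.fst_univ]; exact measure_lt_top _ _⟩
  -- The marginal is dominated, so subtraction of measures is setwise and measurability can be
  -- checked set by set.
  have m1 : Measurable fun e => e.1.1 - (γ e).fst := by
    refine Measure.measurable_of_measurable_coe _ fun s hs => ?_
    simp only [fun e => Measure.sub_apply hs (hγ' e).1, Measure.fst_apply hs]
    exact ((Measure.measurable_coe hs).comp (measurable_subtype_coe.comp measurable_fst)).sub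
      ((Measure.measurable_coe (measurable_fst hs)).comp hγ)
  have m2 : Measurable fun e => e.2.1 - (γ e).snd := by
    refine Measure.measurable_of_measurable_coe _ fun s hs => ?_
    simp only [fun e => Measure.sub_apply hs (hγ' e).2.1, Measure.snd_apply hs]
    exact ((Measure.measurable_coe hs).comp (measurable_subtype_coe.comp measurable_snd)).sub
      ((Measure.measurable_coe (measurable_snd hs)).comp hγ)
  let κ₀ : Kernel (FinMeas X × FinMeas X) (Measure X × Measure X) :=
    ((poissonKernel.comap γ hγ) ×ₖ
      ((poissonKernel.comap _ m1) ×ₖ (poissonKernel.comap _ m2))).map superpose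
  have hκ₀ : ∀ e, κ₀ e = planCoupling (γ e) (e.1.1 - (γ e).fst) (e.2.1 - (γ e).snd) := by
    intro e
    rw [Kernel.map_apply _ measurable_superpose, Kernel.prod_apply, Kernel.prod_apply]
    rfl
  have hfp : Measurable fun e : Measure X × Measure X => (finPart e.1, finPart e.2) :=
    (measurable_finPart.comp measurable_fst).prodMk (measurable_finPart.comp measurable_snd)
  refine ⟨κ₀.comap _ hfp, fun e => ?_⟩
  obtain ⟨h1, h2, h3⟩ := hγ' (finPart e.1, finPart e.2)
  rw [Kernel.comap_apply, hκ₀, planCoupling_fst, planCoupling_snd, add_comm,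
    Measure.sub_add_cancel_of_le h1, add_comm, Measure.sub_add_cancel_of_le h2,
    poissonPointProcess_finPart, poissonPointProcess_finPart]
  refine ⟨rfl, rfl, fun he1 he2 => ?_⟩
  refine (lintegral_wasserstein_planCoupling_le hd _ _ _).trans ?_
  rw [transportCost] at h3
  rw [Measure.sub_apply .univ h1, Measure.sub_apply .univ h2, Measure.fst_univ, Measure.snd_univ]
  simpa only [finPart_of_isFiniteMeasure] using h3

end WassersteinCoupling

section Intensities

/-! ### Stability of the intensity of the next generation -/

theorem bind_apply_le_mul {X : Type*} [MeasurableSpace X] (Q : Kernel X X) (b : Measure X)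
    {s : Set X} (hs : MeasurableSet s) {c : ℝ≥0∞} (h : ∀ᵐ y ∂b, Q y s ≤ c) :
    b.bind Q s ≤ c * b univ := by
  rw [Measure.bind_apply hs Q.aemeasurable, ← lintegral_const]
  exact lintegral_mono_ae h

theorem integral_bind_kernel {X : Type*} [MeasurableSpace X] (Q : Kernel X X) (b : Measure X)
    {f : X → ℝ} (hf : Integrable f (b.bind Q)) :
    ∫ x, f x ∂(b.bind Q) = ∫ y, ∫ x, f x ∂(Q y) ∂b := by
  rw [Measure.comp_eq_comp_const_apply] at hf ⊢
  rw [Kernel.integral_comp hf, Kernel.const_apply]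

variable {X : Type u} [MetricSpace X] [MeasurableSpace X]

theorem abs_integral_sub_integral_le {μ ν : Measure X} {c : ℝ} (hc : 0 ≤ c)
    (h : wasserstein μ ν ≤ ENNReal.ofReal c) {F : X → ℝ} (hF : LipschitzWith 1 F)
    (hb : ∀ x, |F x| ≤ 1) : |∫ x, F x ∂μ - ∫ x, F x ∂ν| ≤ c := by
  rw [abs_le]
  refine ⟨?_, integral_sub_integral_le_of_wasserstein_le hc h hF hb⟩
  have := integral_sub_integral_le_of_wasserstein_le hc h (F := fun x => -F x) hF.neg
    (fun x => by rw [abs_neg]; exact hb x)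
  rw [integral_neg, integral_neg] at this
  linarith

/-- The constant `1` is an admissible test function, so the distance controls total masses. -/
theorem univ_le_add_of_wasserstein_le {μ ν : Measure X} [IsFiniteMeasure μ] [IsFiniteMeasure ν]
    {c : ℝ} (hc : 0 ≤ c) (h : wasserstein μ ν ≤ ENNReal.ofReal c) :
    ν univ ≤ μ univ + ENNReal.ofReal c := by
  have := abs_integral_sub_integral_le hc h (F := fun _ => 1) (LipschitzWith.const' 1) (by simp)
  simp only [integral_const, smul_eq_mul, mul_one] at this
  rw [← ofReal_measureReal (μ := μ), ← ofReal_measureReal (μ := ν),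
    ← ENNReal.ofReal_add measureReal_nonneg hc]
  exact ENNReal.ofReal_le_ofReal (by linarith [(abs_le.1 this).1])

theorem integral_sub_integral_le_mul_wasserstein {μ ν : Measure X} [IsFiniteMeasure μ]
    [IsFiniteMeasure ν] {K : NNReal} (hK : 0 < K) {F : X → ℝ} (hF : LipschitzWith K F)
    (hb : ∀ x, |F x| ≤ K) :
    ∫ x, F x ∂μ - ∫ x, F x ∂ν ≤ K * (wasserstein μ ν).toReal := by
  have hK' : (0 : ℝ) < K := hK
  have h1 : LipschitzWith 1 fun x => (K : ℝ)⁻¹ * F x := by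
    refine LipschitzWith.of_dist_le_mul fun x y => ?_
    have := hF.dist_le_mul x y
    rw [Real.dist_eq] at this ⊢
    rw [← mul_sub, abs_mul, abs_of_pos (inv_pos.2 hK'), NNReal.coe_one, one_mul,
      inv_mul_le_iff₀ hK']
    exact this
  have h2 : ∀ x, |(K : ℝ)⁻¹ * F x| ≤ 1 := fun x => by
    rw [abs_mul, abs_of_pos (inv_pos.2 hK'), inv_mul_le_iff₀ hK', mul_one]
    exact hb x
  have h3 := integral_sub_integral_le_toReal_wasserstein (μ := μ) (ν := ν) h1 h2
  rw [integral_const_mul, integral_const_mul, ← mul_sub, inv_mul_le_iff₀ hK'] at h3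
  exact h3

variable [BorelSpace X]

/-- For a test function `F`, the function `U y = ∫ F d(Q y)` is `K`-Lipschitz and bounded by `K`, so
passing from `b` to `b'` costs `K ‖b - b'‖₁`. Replacing `Q` by `Qbar` under `b'` then costs `ε` per
unit of mass, because `b'` is carried by `A`. -/
theorem wasserstein_bind_le {K : ℝ} (hK : 0 < K) {Q Qbar : Kernel X X}
    [∀ x, IsFiniteMeasure (Q x)] {A : Set X} {ε : ℝ} (hε : 0 ≤ ε)
    (hQ : ∀ x, Q x univ ≤ ENNReal.ofReal K)
    (hQL : ∀ x y, wasserstein (Q x) (Q y) ≤ ENNReal.ofReal (K * dist x y))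
    (hQQ : ∀ x ∈ A, wasserstein (Q x) (Qbar x) ≤ ENNReal.ofReal ε)
    (b b' : Measure X) [IsFiniteMeasure b] [IsFiniteMeasure b'] (hb' : ∀ᵐ y ∂b', y ∈ A)
    [IsFiniteMeasure (b.bind Q)] [IsFiniteMeasure (b'.bind Qbar)] :
    wasserstein (b.bind Q) (b'.bind Qbar) ≤
      ENNReal.ofReal K * wasserstein b b' + ENNReal.ofReal ε * b' univ := by
  rw [← ofReal_measureReal (μ := b'), ← ENNReal.ofReal_toReal (wasserstein_ne_top b b'),
    ← ENNReal.ofReal_mul hK.le, ← ENNReal.ofReal_mul hε,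
    ← ENNReal.ofReal_add (mul_nonneg hK.le ENNReal.toReal_nonneg)
      (mul_nonneg hε measureReal_nonneg)]
  refine wasserstein_le_ofReal fun F hF hFb => ?_
  have hFm : StronglyMeasurable F := hF.continuous.stronglyMeasurable
  rw [integral_bind_kernel Q b (integrable_of_lipschitzWith_of_abs_le hF hFb _),
    integral_bind_kernel Qbar b' (integrable_of_lipschitzWith_of_abs_le hF hFb _)]
  set U : X → ℝ := fun y => ∫ x, F x ∂(Q y) with hU
  set V : X → ℝ := fun y => ∫ x, F x ∂(Qbar y) with hV
  have hKn : ((Real.toNNReal K : NNReal) : ℝ) = K := Real.coe_toNNReal K hK.le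
  have hUL : LipschitzWith (Real.toNNReal K) U := by
    refine LipschitzWith.of_dist_le_mul fun x y => ?_
    rw [hKn, Real.dist_eq]
    exact abs_integral_sub_integral_le (mul_nonneg hK.le dist_nonneg) (hQL x y) hF hFb
  have hUb : ∀ y, |U y| ≤ Real.toNNReal K := by
    intro y
    rw [hKn]
    refine (abs_integral_le hFb (Q y)).trans ?_
    rw [one_mul]
    exact ENNReal.toReal_le_of_le_ofReal hK.le (hQ y)
  have hUV : ∀ᵐ y ∂b', |U y - V y| ≤ ε := by
    filter_upwards [hb'] with y hy
    exact abs_integral_sub_integral_le hε (hQQ y hy) hF hFb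
  have hUi : ∀ (μ : Measure X) [IsFiniteMeasure μ], Integrable U μ := fun μ _ =>
    integrable_of_lipschitzWith_of_abs_le hUL hUb μ
  -- Off `A` there is no uniform bound on `Qbar`; `V` is bounded only `b'`-almost everywhere,
  -- through its closeness to `U`.
  have hVi : Integrable V b' := by
    refine Integrable.of_bound hFm.integral_kernel.aestronglyMeasurable (K + ε) ?_
    filter_upwards [hUV] with y hy
    have h1 := hUb y
    rw [hKn] at h1
    rw [Real.norm_eq_abs]
    have h2 := abs_sub_abs_le_abs_sub (V y) (U y)
    rw [abs_sub_comm] at h2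
    linarith
  have h1 := integral_sub_integral_le_mul_wasserstein (μ := b) (ν := b')
    (Real.toNNReal_pos.2 hK) hUL hUb
  rw [hKn] at h1
  have h2 : ∫ y, U y ∂b' - ∫ y, V y ∂b' ≤ ε * b'.real univ := by
    rw [← integral_sub (hUi b') hVi]
    exact (le_abs_self _).trans (norm_integral_le_of_norm_le_const (f := fun y => U y - V y) hUV)
  linarith

end Intensities

section Recursion

/-! ### The recursive coupling -/

theorem id_prod_map_apply {S Y Z : Type*} [MeasurableSpace S] [MeasurableSpace Y]
    [MeasurableSpace Z] (η : Kernel S Y) [IsMarkovKernel η] {f : S × Y → Z} (hf : Measurable f)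
    (s : S) : ((Kernel.id ×ₖ η).map f) s = (η s).map fun y => f (s, y) := by
  rw [Kernel.map_apply _ hf, Kernel.prod_apply, Kernel.id_apply, Measure.dirac_prod,
    Measure.map_map hf measurable_prodMk_left]
  rfl

theorem bind_comp_eq {S T Z : Type*} [MeasurableSpace S] [MeasurableSpace T] [MeasurableSpace Z]
    (Γ : Measure S) {f : S → T} (hf : Measurable f) {g : T → Measure Z} (hg : Measurable g) :
    Γ.bind (fun s => g (f s)) = (Γ.map f).bind g := by
  ext s hs
  rw [Measure.bind_apply hs (show AEMeasurable (fun s => g (f s)) Γ from (hg.comp hf).aemeasurable), Measure.bind_apply hs hg.aemeasurable,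
    lintegral_map (f := fun t => g t s) ((Measure.measurable_coe hs).comp hg) hf]

variable {X : Type u} [MeasurableSpace X]

/-- One step of the Markov chain `(μ^{[n]}, μ^n)`. -/
noncomputable def stepKernel (Q : Kernel X X) :
    Kernel (Measure X × Measure X) (Measure X × Measure X) :=
  (Kernel.id ×ₖ nextGeneration Q).map fun q => (q.1.1 + q.2, q.2)

theorem measurable_step :
    Measurable fun q : (Measure X × Measure X) × Measure X => (q.1.1 + q.2, q.2) := by
  fun_prop

theorem stepKernel_apply (Q : Kernel X X) (p : Measure X × Measure X) :
    stepKernel Q p = (poissonPointProcess (p.2.bind Q)).map fun η => (p.1 + η, η) := by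
  rw [stepKernel, id_prod_map_apply _ measurable_step]
  rfl

instance isProbabilityMeasure_recursivePPPPairLaw (Q : Kernel X X) (x : X) (n : ℕ) :
    IsProbabilityMeasure (recursivePPPPairLaw Q x n) := by
  induction n with
  | zero => exact Measure.dirac.isProbabilityMeasure
  | succ n ih => exact Measure.isProbabilityMeasure_map measurable_step.aemeasurable

theorem recursivePPPPairLaw_succ (Q : Kernel X X) (x : X) (n : ℕ) :
    recursivePPPPairLaw Q x (n + 1) = (recursivePPPPairLaw Q x n).bind (stepKernel Q) := by
  rw [recursivePPPPairLaw, Measure.compProd_eq_comp_prod, Measure.map_comp _ _ measurable_step]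
  rfl

/-- States of the coupled chain. -/
abbrev PairState (X : Type*) [MeasurableSpace X] :=
  (Measure X × Measure X) × (Measure X × Measure X)

/-- The intensities of the next generations of the coupled chain. -/
noncomputable def nextIntensities (Q Qbar : Kernel X X) (s : PairState X) :
    Measure X × Measure X := (s.1.2.bind Q, s.2.2.bind Qbar)

theorem measurable_nextIntensities (Q Qbar : Kernel X X) :
    Measurable (nextIntensities Q Qbar) :=
  ((Measure.measurable_bind' Q.measurable).comp (measurable_snd.comp measurable_fst)).prodMk
    ((Measure.measurable_bind' Qbar.measurable).comp (measurable_snd.comp measurable_snd))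

/-- Adds a new pair of generations to the state of the coupled chain. -/
noncomputable def addGeneration (q : PairState X × (Measure X × Measure X)) : PairState X :=
  ((q.1.1.1 + q.2.1, q.2.1), (q.1.2.1 + q.2.2, q.2.2))

theorem measurable_addGeneration : Measurable (addGeneration (X := X)) := by
  unfold addGeneration
  fun_prop

/-- One step of the coupled chain. -/
noncomputable def coupledStep (Q Qbar : Kernel X X)
    (κ : Kernel (Measure X × Measure X) (Measure X × Measure X)) :
    Kernel (PairState X) (PairState X) :=
  (Kernel.id ×ₖ κ.comap _ (measurable_nextIntensities Q Qbar)).map addGeneration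

theorem coupledStep_apply (Q Qbar : Kernel X X)
    (κ : Kernel (Measure X × Measure X) (Measure X × Measure X)) [IsMarkovKernel κ]
    (s : PairState X) :
    coupledStep Q Qbar κ s =
      (κ (nextIntensities Q Qbar s)).map fun η => addGeneration (s, η) := by
  rw [coupledStep, id_prod_map_apply _ measurable_addGeneration, Kernel.comap_apply]

/-- The first marginal of `κ` depends only on the first intensity, hence only on the first component
of the state; that component is thus a chain on its own, whatever the joint law. -/
theorem map_fst_bind_coupledStep (Q Qbar : Kernel X X)
    (κ : Kernel (Measure X × Measure X) (Measure X × Measure X)) [IsMarkovKernel κ]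
    (hκ : ∀ e, (κ e).map Prod.fst = poissonPointProcess e.1) (Γ : Measure (PairState X)) :
    (Γ.bind (coupledStep Q Qbar κ)).map Prod.fst = (Γ.map Prod.fst).bind (stepKernel Q) := by
  rw [Measure.map_comp _ _ measurable_fst,
    ← bind_comp_eq Γ measurable_fst (stepKernel Q).measurable]
  congr 1
  funext s
  have h : Measurable fun η : Measure X => (s.1.1 + η, η) := by fun_prop
  rw [Kernel.map_apply _ measurable_fst, coupledStep_apply, stepKernel_apply,
    Measure.map_map measurable_fst
      (show Measurable fun η => addGeneration (s, η) from
        measurable_addGeneration.comp measurable_prodMk_left)]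
  have h1 := hκ (nextIntensities Q Qbar s)
  rw [nextIntensities] at h1 ⊢
  rw [← h1, Measure.map_map h measurable_fst]
  rfl

theorem map_snd_bind_coupledStep (Q Qbar : Kernel X X)
    (κ : Kernel (Measure X × Measure X) (Measure X × Measure X)) [IsMarkovKernel κ]
    (hκ : ∀ e, (κ e).map Prod.snd = poissonPointProcess e.2) (Γ : Measure (PairState X)) :
    (Γ.bind (coupledStep Q Qbar κ)).map Prod.snd = (Γ.map Prod.snd).bind (stepKernel Qbar) := by
  rw [Measure.map_comp _ _ measurable_snd,
    ← bind_comp_eq Γ measurable_snd (stepKernel Qbar).measurable]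
  congr 1
  funext s
  have h : Measurable fun η : Measure X => (s.2.1 + η, η) := by fun_prop
  rw [Kernel.map_apply _ measurable_snd, coupledStep_apply, stepKernel_apply,
    Measure.map_map measurable_snd
      (show Measurable fun η => addGeneration (s, η) from
        measurable_addGeneration.comp measurable_prodMk_left)]
  have h1 := hκ (nextIntensities Q Qbar s)
  rw [nextIntensities] at h1 ⊢
  rw [← h1, Measure.map_map h measurable_snd]
  rfl

/-- The states in which the second process has stayed in `A`. -/
def goodStates (A : Set X) : Set (PairState X) := {s | s.2.1 Aᶜ = 0}

theorem measurableSet_goodStates {A : Set X} (hA : MeasurableSet A) :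
    MeasurableSet (goodStates A) :=
  measurableSet_eq_fun ((Measure.measurable_coe hA.compl).comp
    (measurable_fst.comp measurable_snd)) measurable_const

/-- States with finite total masses, in which the last generation of the second process charges
the complement of `A` at most as much as the whole process. -/
def regularStates (A : Set X) : Set (PairState X) :=
  {s | IsFiniteMeasure s.1.1 ∧ IsFiniteMeasure s.1.2 ∧ IsFiniteMeasure s.2.1 ∧
    IsFiniteMeasure s.2.2 ∧ s.2.2 Aᶜ ≤ s.2.1 Aᶜ}

theorem measurableSet_regularStates {A : Set X} (hA : MeasurableSet A) :
    MeasurableSet (regularStates A) := by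
  have h : MeasurableSet {μ : Measure X | IsFiniteMeasure μ} := measurableSet_isFiniteMeasure
  have hc := Measure.measurable_coe (α := X) hA.compl
  exact ((measurable_fst.comp measurable_fst) h).inter
    (((measurable_snd.comp measurable_fst) h).inter
    (((measurable_fst.comp measurable_snd) h).inter
    (((measurable_snd.comp measurable_snd) h).inter
    (measurableSet_le (hc.comp (measurable_snd.comp measurable_snd))
      (hc.comp (measurable_fst.comp measurable_snd))))))

end Recursion

/-- Without measurability of `f` the lower integral may be smaller than `f a`, but one inequality
survives; it serves for `stateDist`. -/
theorem lintegral_dirac_le {S : Type*} [MeasurableSpace S] (a : S) (f : S → ℝ≥0∞) :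
    ∫⁻ s, f s ∂(Measure.dirac a) ≤ f a := by
  obtain ⟨g, hg, hgf, h⟩ := exists_measurable_le_lintegral_eq (Measure.dirac a) f
  rw [h, lintegral_dirac' a hg]
  exact hgf a

/-! ### Estimates along the coupled chain -/

section CoupledChain

variable {X : Type u} [MetricSpace X] [MeasurableSpace X]

/-- The sum of the distances of the two whole processes and of their last generations. -/
noncomputable def stateDist (s : PairState X) : ℝ≥0∞ :=
  wasserstein s.1.1 s.2.1 + wasserstein s.1.2 s.2.2

/-- `Γ` is a coupling of the pair laws at depth `n`, for which `t` bounds the expected distance on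
the good states, `p` the probability of the other states, and `m` the expected size of the last
generation of the second process on the good states. -/
structure IsCoupledChain (Q Qbar : Kernel X X) (x xbar : X) (A : Set X) (n : ℕ)
    (Γ : Measure (PairState X)) (t p m : ℝ≥0∞) : Prop where
  map_fst : Γ.map Prod.fst = recursivePPPPairLaw Q x n
  map_snd : Γ.map Prod.snd = recursivePPPPairLaw Qbar xbar n
  ae_regular : ∀ᵐ s ∂Γ, s ∈ regularStates A
  lintegral_dist_le : ∫⁻ s, (goodStates A).indicator stateDist s ∂Γ ≤ t
  measure_compl_le : Γ (goodStates A)ᶜ ≤ p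
  lintegral_mass_le : ∫⁻ s, (goodStates A).indicator (fun s => s.2.2 univ) s ∂Γ ≤ m

theorem IsCoupledChain.measure_univ {Q Qbar : Kernel X X} {x xbar : X} {A : Set X} {n : ℕ}
    {Γ : Measure (PairState X)} {t p m : ℝ≥0∞} (h : IsCoupledChain Q Qbar x xbar A n Γ t p m) :
    Γ univ = 1 := by
  have := congrArg (fun μ => μ univ) h.map_fst
  simpa [Measure.map_apply measurable_fst] using this

theorem isCoupledChain_zero (Q Qbar : Kernel X X) (x xbar : X) {A : Set X} (hA : MeasurableSet A)
    (hx : xbar ∈ A) (d : ℝ≥0∞)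
    (hd : wasserstein (Measure.dirac x) (Measure.dirac xbar) ≤ d) :
    IsCoupledChain Q Qbar x xbar A 0 (Measure.dirac
      ((Measure.dirac x, Measure.dirac x), (Measure.dirac xbar, Measure.dirac xbar)))
      (2 * d) 0 1 where
  map_fst := by rw [Measure.map_dirac' measurable_fst]; rfl
  map_snd := by rw [Measure.map_dirac' measurable_snd]; rfl
  ae_regular := by
    refine (ae_dirac_iff (p := fun s => s ∈ regularStates A)
      (measurableSet_regularStates hA)).2 ?_
    exact ⟨inferInstance, inferInstance, inferInstance, inferInstance, le_rfl⟩
  lintegral_dist_le := by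
    refine (lintegral_dirac_le _ _).trans ((indicator_le_self _ _ _).trans ?_)
    rw [stateDist, two_mul]
    exact add_le_add hd hd
  measure_compl_le := by
    rw [Measure.dirac_apply' _ (measurableSet_goodStates hA).compl, nonpos_iff_eq_zero,
      indicator_eq_zero_iff_notMem, notMem_compl_iff]
    change Measure.dirac xbar Aᶜ = 0
    rw [Measure.dirac_apply' _ hA.compl]
    simpa using hx
  lintegral_mass_le := by
    refine (lintegral_dirac_le _ _).trans ((indicator_le_self _ _ _).trans ?_)
    simp

variable [BorelSpace X]

theorem wasserstein_dirac_le (x y : X) :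
    wasserstein (Measure.dirac x) (Measure.dirac y) ≤ ENNReal.ofReal (dist x y) := by
  refine wasserstein_le_ofReal fun F hF hb => ?_
  rw [integral_dirac' F x hF.continuous.stronglyMeasurable,
    integral_dirac' F y hF.continuous.stronglyMeasurable]
  have := hF.dist_le_mul x y
  rw [Real.dist_eq, NNReal.coe_one, one_mul] at this
  exact (le_abs_self _).trans this

/-- Propagation of the bounds from one generation to the next. -/
theorem IsCoupledChain.succ {K : ℝ} (hK : 0 < K) {Q Qbar : Kernel X X}
    (hQf : ∀ x, IsFiniteMeasure (Q x)) (hQbf : ∀ x, IsFiniteMeasure (Qbar x))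
    {A : Set X} (hA : MeasurableSet A) {ε : ℝ} (hε : 0 ≤ ε) (hε1 : ε ≤ 1)
    (hQ : ∀ x, Q x univ ≤ ENNReal.ofReal K)
    (hQL : ∀ x y, wasserstein (Q x) (Q y) ≤ ENNReal.ofReal (K * dist x y))
    (hQA : ∀ x ∈ A, Qbar x Aᶜ ≤ ENNReal.ofReal ε)
    (hQQ : ∀ x ∈ A, wasserstein (Q x) (Qbar x) ≤ ENNReal.ofReal ε)
    (κ : Kernel (Measure X × Measure X) (Measure X × Measure X)) [IsMarkovKernel κ]
    (hκ1 : ∀ e, (κ e).map Prod.fst = poissonPointProcess e.1)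
    (hκ2 : ∀ e, (κ e).map Prod.snd = poissonPointProcess e.2)
    (hκ : ∀ e : Measure X × Measure X, IsFiniteMeasure e.1 → IsFiniteMeasure e.2 →
      ∫⁻ p, wasserstein p.1 p.2 ∂(κ e) ≤ wasserstein e.1 e.2 + ENNReal.ofReal ε)
    {x xbar : X} {n : ℕ} {Γ : Measure (PairState X)} {t p m : ℝ≥0∞}
    (h : IsCoupledChain Q Qbar x xbar A n Γ t p m) :
    IsCoupledChain Q Qbar x xbar A (n + 1) (Γ.bind (coupledStep Q Qbar κ))
      ((2 * ENNReal.ofReal K + 1) * t + 2 * ENNReal.ofReal ε * (m + 1))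
      (p + ENNReal.ofReal ε * m) ((ENNReal.ofReal K + 1) * m) := by
  set k := ENNReal.ofReal K with hk
  set e := ENNReal.ofReal ε with he
  have hG := measurableSet_goodStates hA
  -- On `A` the mass of `Qbar y` exceeds that of `Q y` by at most `ε ≤ 1`.
  have hmass : ∀ y ∈ A, Qbar y univ ≤ k + 1 := fun y hy =>
    (univ_le_add_of_wasserstein_le hε (hQQ y hy)).trans
      (add_le_add (hQ y) (ENNReal.ofReal_le_one.2 hε1))
  have hfin : ∀ w, ∀ᵐ η ∂(κ w), IsFiniteMeasure η.1 ∧ IsFiniteMeasure η.2 := by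
    intro w
    have h1 := ae_isFiniteMeasure_poissonPointProcess w.1
    have h2 := ae_isFiniteMeasure_poissonPointProcess w.2
    rw [← hκ1 w] at h1
    rw [← hκ2 w] at h2
    filter_upwards [ae_of_ae_map measurable_fst.aemeasurable h1,
      ae_of_ae_map measurable_snd.aemeasurable h2] with η h3 h4
    exact ⟨h3, h4⟩
  have hAe : ∀ s ∈ regularStates A, s ∈ goodStates A → ∀ᵐ y ∂s.2.2, y ∈ A := fun s hs hsG =>
    mem_ae_iff.2 (le_antisymm (hs.2.2.2.2.trans_eq hsG) zero_le)
  have hint1 : ∀ s ∈ regularStates A, IsFiniteMeasure (nextIntensities Q Qbar s).1 := by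
    intro s hs
    have := hs.2.1
    exact ⟨(bind_apply_le_mul Q s.1.2 .univ (ae_of_all _ hQ)).trans_lt
      (ENNReal.mul_lt_top ENNReal.ofReal_lt_top (measure_lt_top _ _))⟩
  have hint2 : ∀ s ∈ regularStates A, s ∈ goodStates A →
      (nextIntensities Q Qbar s).2 univ ≤ (k + 1) * s.2.2 univ := fun s hs hsG =>
    bind_apply_le_mul Qbar s.2.2 .univ ((hAe s hs hsG).mono hmass)
  have hint2' : ∀ s ∈ regularStates A, s ∈ goodStates A →
      IsFiniteMeasure (nextIntensities Q Qbar s).2 := by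
    intro s hs hsG
    have := hs.2.2.2.1
    exact ⟨(hint2 s hs hsG).trans_lt (ENNReal.mul_lt_top
      (ENNReal.add_lt_top.2 ⟨ENNReal.ofReal_lt_top, ENNReal.one_lt_top⟩) (measure_lt_top _ _))⟩
  -- Goodness is tested on the accumulated process, so bad states are absorbing and contribute
  -- nothing to the truncated integrals.
  have hnotG : ∀ (s : PairState X) η, s ∉ goodStates A → addGeneration (s, η) ∉ goodStates A := by
    intro s η hs h'
    exact hs (add_eq_zero.1 h').1
  have hadd : ∀ s : PairState X, Measurable fun η => addGeneration (s, η) := fun s =>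
    measurable_addGeneration.comp measurable_prodMk_left
  refine ⟨?_, ?_, ?_, ?_, ?_, ?_⟩
  · rw [map_fst_bind_coupledStep Q Qbar κ hκ1, h.map_fst, recursivePPPPairLaw_succ]
  · rw [map_snd_bind_coupledStep Q Qbar κ hκ2, h.map_snd, recursivePPPPairLaw_succ]
  · refine Measure.ae_comp_of_ae_ae (measurableSet_regularStates hA) ?_
    filter_upwards [h.ae_regular] with s hs
    rw [coupledStep_apply]
    refine (ae_map_iff (p := fun s => s ∈ regularStates A) (hadd s).aemeasurable
      (measurableSet_regularStates hA)).2 ?_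
    filter_upwards [hfin (nextIntensities Q Qbar s)] with η hη
    have := hs.1
    have := hs.2.2.1
    have := hη.1
    have := hη.2
    refine ⟨?_, hη.1, ?_, hη.2, ?_⟩
    · exact inferInstanceAs (IsFiniteMeasure (s.1.1 + η.1))
    · exact inferInstanceAs (IsFiniteMeasure (s.2.1 + η.2))
    · change η.2 Aᶜ ≤ (s.2.1 + η.2) Aᶜ
      rw [Measure.add_apply]
      exact le_add_self
  -- The new pair of generations enters both summands of `stateDist`, whence the factors `2`; the
  -- coupling error contributes the `1` in `s.2.2 univ + 1`.
  · have hstep : ∀ s ∈ regularStates A, s ∈ goodStates A →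
        ∫⁻ s', (goodStates A).indicator stateDist s' ∂(coupledStep Q Qbar κ s) ≤
          (2 * k + 1) * stateDist s + 2 * e * (s.2.2 univ + 1) := by
      intro s hs hsG
      have f1 := hs.1
      have f2 := hs.2.1
      have f3 := hs.2.2.1
      have f4 := hs.2.2.2.1
      have f5 := hint1 s hs
      have f6 := hint2' s hs hsG
      have hW : wasserstein (nextIntensities Q Qbar s).1 (nextIntensities Q Qbar s).2 ≤
          k * wasserstein s.1.2 s.2.2 + e * s.2.2 univ := by
        unfold nextIntensities at f5 f6
        exact wasserstein_bind_le hK hε hQ hQL hQQ s.1.2 s.2.2 (hAe s hs hsG)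
      rw [coupledStep_apply]
      calc _ ≤ ∫⁻ η, (goodStates A).indicator stateDist (addGeneration (s, η))
              ∂(κ (nextIntensities Q Qbar s)) := lintegral_map_le _ _
        _ ≤ ∫⁻ η, (wasserstein s.1.1 s.2.1 + 2 * wasserstein η.1 η.2)
              ∂(κ (nextIntensities Q Qbar s)) := by
          refine lintegral_mono_ae ?_
          filter_upwards [hfin (nextIntensities Q Qbar s)] with η hη
          have := hη.1
          have := hη.2
          refine (indicator_le_self _ _ _).trans ?_
          rw [two_mul, ← add_assoc]
          exact add_le_add_left (wasserstein_add_le _ _ _ _) _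
        _ = wasserstein s.1.1 s.2.1 +
              2 * ∫⁻ η, wasserstein η.1 η.2 ∂(κ (nextIntensities Q Qbar s)) := by
          rw [lintegral_add_left measurable_const, lintegral_const,
            MeasureTheory.measure_univ, mul_one, lintegral_const_mul' _ _ (by simp)]
        _ ≤ wasserstein s.1.1 s.2.1 +
              2 * (k * wasserstein s.1.2 s.2.2 + e * s.2.2 univ + e) := by
          gcongr
          exact (hκ _ f5 f6).trans (add_le_add_left hW _)
        -- Slack is added so that both distances carry the same coefficient `2 * k + 1`.
        _ ≤ wasserstein s.1.1 s.2.1 +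
              2 * (k * wasserstein s.1.2 s.2.2 + e * s.2.2 univ + e) +
              (2 * k * wasserstein s.1.1 s.2.1 + wasserstein s.1.2 s.2.2) := le_self_add
        _ = _ := by
          rw [stateDist]
          ring
    have hmu : Measurable fun s : PairState X => s.2.2 univ :=
      (Measure.measurable_coe .univ).comp (measurable_snd.comp measurable_snd)
    calc _ ≤ ∫⁻ s, ∫⁻ s', (goodStates A).indicator stateDist s' ∂(coupledStep Q Qbar κ s) ∂Γ :=
          Measure.lintegral_bind_le _ _ _
      _ ≤ ∫⁻ s, ((2 * k + 1) * (goodStates A).indicator stateDist s +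
            2 * e * ((goodStates A).indicator (fun s => s.2.2 univ) s + 1)) ∂Γ := by
        refine lintegral_mono_ae ?_
        filter_upwards [h.ae_regular] with s hs
        by_cases hsG : s ∈ goodStates A
        · rw [indicator_of_mem hsG, indicator_of_mem hsG]
          exact hstep s hs hsG
        · rw [coupledStep_apply]
          refine (lintegral_map_le _ _).trans ?_
          have : ∀ η, (goodStates A).indicator stateDist (addGeneration (s, η)) = 0 := fun η =>
            indicator_of_notMem (hnotG s η hsG) _
          simp [this]
      _ = (2 * k + 1) * ∫⁻ s, (goodStates A).indicator stateDist s ∂Γ +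
            2 * e * (∫⁻ s, (goodStates A).indicator (fun s => s.2.2 univ) s ∂Γ + 1) := by
        have hm1 : Measurable fun s : PairState X =>
            2 * e * ((goodStates A).indicator (fun s => s.2.2 univ) s + 1) :=
          ((hmu.indicator hG).add measurable_const).const_mul _
        rw [lintegral_add_right _ hm1,
          lintegral_const_mul' _ _ (by finiteness),
          lintegral_const_mul' _ _ (by finiteness),
          lintegral_add_right _ measurable_const, lintegral_const, one_mul, h.measure_univ]
      _ ≤ _ := by
        gcongr
        · exact h.lintegral_dist_le
        · exact h.lintegral_mass_le
  · have hmu : Measurable fun s : PairState X => s.2.2 univ :=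
      (Measure.measurable_coe .univ).comp (measurable_snd.comp measurable_snd)
    rw [Measure.bind_apply hG.compl (coupledStep Q Qbar κ).aemeasurable]
    calc _ ≤ ∫⁻ s, ((goodStates A)ᶜ.indicator 1 s +
            e * (goodStates A).indicator (fun s => s.2.2 univ) s) ∂Γ := by
          refine lintegral_mono_ae ?_
          filter_upwards [h.ae_regular] with s hs
          rw [coupledStep_apply, Measure.map_apply (hadd s) hG.compl]
          by_cases hsG : s ∈ goodStates A
          · rw [indicator_of_notMem (fun h' : s ∈ (goodStates A)ᶜ => h' hsG), indicator_of_mem hsG, zero_add]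
            have f6 := hint2' s hs hsG
            have h0 : s.2.1 Aᶜ = 0 := hsG
            -- From a good state, escape means exactly that the new generation charges `Aᶜ`, and its
            -- intensity gives `Aᶜ` mass at most `e * s.2.2 univ`.
            have hset : (fun η => addGeneration (s, η)) ⁻¹' (goodStates A)ᶜ =
                Prod.snd ⁻¹' {η : Measure X | η Aᶜ ≠ 0} := by
              ext η
              change ¬ (s.2.1 + η.2) Aᶜ = 0 ↔ ¬ η.2 Aᶜ = 0
              rw [Measure.add_apply, h0, zero_add]
            have hms : MeasurableSet {η : Measure X | η Aᶜ ≠ 0} :=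
              (measurableSet_eq_fun (Measure.measurable_coe hA.compl) measurable_const).compl
            rw [hset, ← Measure.map_apply measurable_snd hms, hκ2]
            exact (poissonPointProcess_ne_zero_le _ hA.compl).trans
              (bind_apply_le_mul Qbar s.2.2 hA.compl ((hAe s hs hsG).mono hQA))
          · rw [indicator_of_mem (by exact hsG)]
            exact prob_le_one.trans le_self_add
      _ = Γ (goodStates A)ᶜ +
            e * ∫⁻ s, (goodStates A).indicator (fun s => s.2.2 univ) s ∂Γ := by
        rw [lintegral_add_right _ ((hmu.indicator hG).const_mul _),
          lintegral_indicator_one hG.compl, lintegral_const_mul' _ _ (by finiteness)]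
      _ ≤ _ := by
        gcongr
        · exact h.measure_compl_le
        · exact h.lintegral_mass_le
  · calc _ ≤ ∫⁻ s, ∫⁻ s', (goodStates A).indicator (fun s => s.2.2 univ) s'
            ∂(coupledStep Q Qbar κ s) ∂Γ := Measure.lintegral_bind_le _ _ _
      _ ≤ ∫⁻ s, (k + 1) * (goodStates A).indicator (fun s => s.2.2 univ) s ∂Γ := by
        refine lintegral_mono_ae ?_
        filter_upwards [h.ae_regular] with s hs
        rw [coupledStep_apply]
        refine (lintegral_map_le _ _).trans ?_
        by_cases hsG : s ∈ goodStates A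
        · have f6 := hint2' s hs hsG
          rw [indicator_of_mem hsG]
          refine le_trans ?_ (hint2 s hs hsG)
          rw [← lintegral_poissonPointProcess_apply _ .univ, ← hκ2,
            lintegral_map (Measure.measurable_coe .univ) measurable_snd]
          exact lintegral_mono fun η => indicator_le_self _ _ _
        · have : ∀ η, (goodStates A).indicator (fun s : PairState X => s.2.2 univ)
              (addGeneration (s, η)) = 0 := fun η => indicator_of_notMem (hnotG s η hsG) _
          simp [this]
      _ = (k + 1) * ∫⁻ s, (goodStates A).indicator (fun s => s.2.2 univ) s ∂Γ :=
        lintegral_const_mul' _ _ (by finiteness)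
      _ ≤ _ := by
        gcongr
        exact h.lintegral_mass_le

/-- The constants in the recursive estimate. -/
noncomputable def chainConst (k : ℝ≥0∞) : ℕ → ℝ≥0∞
  | 0 => 2
  | n + 1 => (2 * k + 1) * chainConst k n + 3 * ((k + 1) ^ n + 1)

theorem chainConst_ne_top {k : ℝ≥0∞} (hk : k ≠ ∞) (n : ℕ) : chainConst k n ≠ ∞ := by
  induction n with
  | zero => simp [chainConst]
  | succ n ih =>
    rw [chainConst]
    finiteness

variable [SecondCountableTopology X]

theorem exists_isCoupledChain {K : ℝ} (hK : 0 < K) (hd : ∀ x y : X, dist x y ≤ 1)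
    {Q Qbar : Kernel X X}
    (hQf : ∀ x, IsFiniteMeasure (Q x)) (hQbf : ∀ x, IsFiniteMeasure (Qbar x))
    {A : Set X} (hA : MeasurableSet A) {ε : ℝ} (hε : 0 < ε) (hε1 : ε ≤ 1)
    (hQ : ∀ x, Q x univ ≤ ENNReal.ofReal K)
    (hQL : ∀ x y, wasserstein (Q x) (Q y) ≤ ENNReal.ofReal (K * dist x y))
    (hQA : ∀ x ∈ A, Qbar x Aᶜ ≤ ENNReal.ofReal ε)
    (hQQ : ∀ x ∈ A, wasserstein (Q x) (Qbar x) ≤ ENNReal.ofReal ε)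
    {x xbar : X} (hx : xbar ∈ A) (n : ℕ) :
    ∃ Γ t p, IsCoupledChain Q Qbar x xbar A n Γ t p ((ENNReal.ofReal K + 1) ^ n) ∧
      t + p ≤ chainConst (ENNReal.ofReal K) n *
        (ENNReal.ofReal ε + ENNReal.ofReal (dist x xbar)) := by
  have : Nonempty X := ⟨x⟩
  -- The coupling error is chosen equal to `ε`, the order already present in the estimate.
  obtain ⟨κ, hκ⟩ := exists_poisson_coupling hd hε
  have hM : IsMarkovKernel κ := ⟨fun e => ⟨by
    have := congrArg (fun μ => μ univ) (hκ e).1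
    simpa [Measure.map_apply measurable_fst] using this⟩⟩
  induction n with
  | zero =>
    refine ⟨_, _, _, isCoupledChain_zero Q Qbar x xbar hA hx _ (wasserstein_dirac_le x xbar), ?_⟩
    rw [add_zero, chainConst]
    gcongr
    exact le_add_self
  | succ n ih =>
    obtain ⟨Γ, t, p, h, hle⟩ := ih
    have h' := h.succ hK hQf hQbf hA hε.le hε1 hQ hQL hQA hQQ κ (fun e => (hκ e).1)
      (fun e => (hκ e).2.1) (fun e => (hκ e).2.2)
    rw [← pow_succ'] at h'
    refine ⟨_, _, _, h', ?_⟩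
    rw [chainConst]
    set k := ENNReal.ofReal K
    set e := ENNReal.ofReal ε
    set d := ENNReal.ofReal (dist x xbar)
    -- With `m = (k + 1) ^ n`, the new errors `2 e (m + 1)` and `e m` are at most `3 e (m + 1)`, the
    -- source of the `3` in `chainConst`.
    calc (2 * k + 1) * t + 2 * e * ((k + 1) ^ n + 1) + (p + e * (k + 1) ^ n)
        ≤ (2 * k + 1) * t + 2 * e * ((k + 1) ^ n + 1) + (p + e * (k + 1) ^ n) +
          (2 * k * p + e + 3 * ((k + 1) ^ n + 1) * d) := le_self_add
      _ = (2 * k + 1) * (t + p) + 3 * ((k + 1) ^ n + 1) * (e + d) := by ring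
      _ ≤ (2 * k + 1) * (chainConst k n * (e + d)) + 3 * ((k + 1) ^ n + 1) * (e + d) := by gcongr
      _ = _ := by ring

end CoupledChain

end RecursivePPP

/-! ### Conclusion: the coupling of the full processes -/

open RecursivePPP in
theorem mainTheorem9 (K : ℝ) (hK : 1 ≤ K) (n : ℕ) (hn : 0 < n) :
    ∃ C : ℝ, 0 < C ∧
      ∀ (X : Type u) [MetricSpace X] [PolishSpace X] [MeasurableSpace X] [BorelSpace X]
        (_ : ∀ x y : X, dist x y ≤ 1)
        (Q Qbar : Kernel X X)
        (_ : ∀ x, IsFiniteMeasure (Q x)) (_ : ∀ x, IsFiniteMeasure (Qbar x))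
        (A : Set X) (_ : MeasurableSet A) (ε : ℝ) (_ : 0 < ε) (_ : ε ≤ 1)
        (_ : ∀ x, Q x univ ≤ ENNReal.ofReal K)
        (_ : ∀ x y, RecursivePPP.wasserstein (Q x) (Q y) ≤ ENNReal.ofReal (K * dist x y))
        (_ : ∀ x ∈ A, Qbar x Aᶜ ≤ ENNReal.ofReal ε)
        (_ : ∀ x ∈ A, RecursivePPP.wasserstein (Q x) (Qbar x) ≤ ENNReal.ofReal ε)
        (xbar : X) (_ : xbar ∈ A) (x : X),
        ∃ Γ : Measure (Measure X × Measure X),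
          Γ.map Prod.fst = RecursivePPP.recursivePPP Q x n ∧
          Γ.map Prod.snd = RecursivePPP.recursivePPP Qbar xbar n ∧
          ∫⁻ p, min 1 (RecursivePPP.wasserstein p.1 p.2) ∂Γ ≤
            ENNReal.ofReal (C * (√ε + dist x xbar)) := by
  have hc := chainConst_ne_top (ENNReal.ofReal_ne_top (r := K)) n
  -- Adding `1` makes positivity immediate; the constant depends on `K` and `n` only.
  refine ⟨(chainConst (ENNReal.ofReal K) n).toReal + 1, by positivity, ?_⟩
  intro X _ _ _ _ hd Q Qbar hQf hQbf A hA ε hε hε1 hQ hQL hQA hQQ xbar hx x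
  obtain ⟨Γ, t, p, h, hle⟩ := exists_isCoupledChain (by linarith) hd hQf hQbf hA hε hε1 hQ hQL hQA
    hQQ (x := x) hx n
  have hG := measurableSet_goodStates hA
  have hm : Measurable fun s : PairState X => (s.1.1, s.2.1) := by fun_prop
  refine ⟨Γ.map fun s => (s.1.1, s.2.1), ?_, ?_, ?_⟩
  · rw [recursivePPP, ← h.map_fst, Measure.map_map measurable_fst hm,
      Measure.map_map measurable_fst measurable_fst]
    rfl
  · rw [recursivePPP, ← h.map_snd, Measure.map_map measurable_snd hm,
      Measure.map_map measurable_fst measurable_snd]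
    rfl
  · calc ∫⁻ p, min 1 (wasserstein p.1 p.2) ∂(Γ.map fun s => (s.1.1, s.2.1)) ≤
          ∫⁻ s, min 1 (wasserstein s.1.1 s.2.1) ∂Γ :=
        lintegral_map_le (fun p : Measure X × Measure X => min 1 (wasserstein p.1 p.2)) _
      -- The truncation at `1` is what allows the exceptional event to be paid for by its
      -- probability alone.
      _ ≤ ∫⁻ s, ((goodStates A).indicator stateDist s + (goodStates A)ᶜ.indicator 1 s) ∂Γ := by
        refine lintegral_mono fun s => ?_
        by_cases hs : s ∈ goodStates A
        · rw [indicator_of_mem hs]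
          exact (min_le_right _ _).trans (le_self_add.trans le_self_add)
        · rw [indicator_of_mem (show s ∈ (goodStates A)ᶜ from hs)]
          exact (min_le_left _ _).trans le_add_self
      _ ≤ t + p := by
        rw [lintegral_add_right _ (measurable_one.indicator hG.compl),
          lintegral_indicator_one hG.compl]
        exact add_le_add h.lintegral_dist_le h.measure_compl_le
      _ ≤ ENNReal.ofReal (((chainConst (ENNReal.ofReal K) n).toReal + 1) *
            (√ε + dist x xbar)) := by
        refine hle.trans ?_
        rw [← ENNReal.ofReal_add hε.le dist_nonneg, ← ENNReal.ofReal_toReal hc,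
          ← ENNReal.ofReal_mul ENNReal.toReal_nonneg, ENNReal.ofReal_toReal hc]
        refine ENNReal.ofReal_le_ofReal (mul_le_mul (by linarith) ?_ (by positivity)
          (by positivity))
        have : ε ≤ √ε := Real.le_sqrt_of_sq_le (by nlinarith)
        linarith
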